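/- **Definitions.** Let $p\in[0,1]$. $\mathcal C_p$ is the set of *coherent distributions with mean $p$*: the joint laws of $(X_1,X_2)$, $X_i=\mathbb E[X\mid\mathcal F_i]$, where $X$ is a $\{0,1\}$-valued random variable with $\mathbb E[X]=p$ on some probability space $(\Omega,\mathcal F,\mathbb P)$ and $\mathcal F_1,\mathcal F_2\subset\mathcal F$ are sub-$\sigma$-algebras. A probability distribution on the plane is a *ladder distribution with $n$ points* if its support can be written as a sequence of $n$ distinct points $(x_i,y_i)_{i=1}^n$ such that $(x_i)$ and $(y_i)$ are each weakly monotone (increasing or decreasing), $x_i=x_{i+1}$ or $y_i=y_{i+1}$ for every $i<n$, and every horizontal or vertical line contains at most two of the points. **Theorem.** Let $\alpha,\beta\in\mathbb R$, $p\in[0,1]$ and $f(x_1,x_2)=\alpha(x_1-x_2)^2+\beta(x_1+x_2-2p)^2$. (a) If $\alpha<0$ or $2\beta>\alpha$, then $$\max_{\mu\in\mathcal C_p}\int f\,d\mu=\max(0,4\beta,\alpha+\beta)\,p(1-p).$$ (b) If $\alpha\ge\max(0,2\beta)$, the maximum exists and $$\max_{\mu\in\mathcal C_p}\int f\,d\mu\le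 p(1-p)\frac{\alpha^2}{\alpha-\beta}$$ (the right-hand side is read as $0$ when $\alpha=\beta=0$). If $\alpha=0$, the maximum is $0$, so equality holds. If $\alpha>0$, equality holds if and only if there is $N\in\mathbb N$ such that at least one of the following holds: 1. $\frac{\alpha-\beta}{\alpha}=N$ and $\left(2-\frac{\alpha}{\alpha-\beta}\right)p+\frac{\alpha}{\alpha-\beta}\ge 1\ge\left(2-\frac{\alpha}{\alpha-\beta}\right)p$; 2. $\frac{2(\alpha-\beta)-(\alpha-2\beta)p}{\alpha}=N$ and $\left(2-\frac{\alpha}{\alpha-\beta}\right)p+\frac{\alpha}{\alpha-\beta}>1$; 3. $\frac{2(\alpha-\beta)-(\alpha-2\beta)(1-p)}{\alpha}=N$ and $\left(2-\frac{\alpha}{\alpha-\beta}\right)p<1$. (c) Let $\alpha>0$, $\alpha>2\beta$ and $N\in\mathbb N$. - If exactly one of conditions 2 and 3 holds for $N$, the maximum is attained at exactly one $\mu\in\mathcal C_p$, and this $\mu$ is a ladder distribution with $2N-1$ points. - If conditions 2 and 3 both hold for $N$, the set of optimal $\mu\in\mathcal C_p$ is the set of all convex combinations of two distinct ladder distributions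 with $2N-1$ points each. - If condition 1 holds for $N$ and neither condition 2 nor condition 3 does, the set of optimal $\mu\in\mathcal C_p$ is the set of all convex combinations of two distinct ladder distributions with $2N$ points each. (d) If $\alpha=2\beta>0$, the only optimal distribution is $(1-p)\,\delta_{(0,0)}+p\,\delta_{(1,1)}$. -/

import Mathlib

open MeasureTheory
open scoped NNReal ENNReal

/-- `coherentSet p` is the set `𝒞_p` of coherent distributions with mean `p`: the joint laws of
`(E[X | 𝓕₁], E[X | 𝓕₂])`, where `X` is a Bernoulli random variable with `E[X] = p` on some
probability space and `𝓕₁`, `𝓕₂` are sub-σ-algebras. Such a law is regarded as a measure on `ℝ × ℝ`;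
it is automatically concentrated on the unit square. Probability spaces in `Type` suffice: the law of
`(X, X₁, X₂)` on `ℝ × ℝ × ℝ`, with the σ-algebras generated by the last two coordinates, realizes
every such distribution. -/
def coherentSet (p : ℝ) : Set (Measure (ℝ × ℝ)) :=
  {μ | ∃ (Ω : Type) (m₁ m₂ mΩ : MeasurableSpace Ω) (P : Measure Ω) (X : Ω → ℝ),
      IsProbabilityMeasure P ∧ Measurable[mΩ] X ∧ (∀ᵐ ω ∂P, X ω = 0 ∨ X ω = 1) ∧
      ∫ ω, X ω ∂P = p ∧ m₁ ≤ mΩ ∧ m₂ ≤ mΩ ∧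
      μ = P.map (fun ω => (condExp m₁ P X ω, condExp m₂ P X ω))}

/-- The objective `f(x₁, x₂) = α (x₁ - x₂)² + β (x₁ + x₂ - 2p)²`. -/
def quadObjective (α β p : ℝ) (z : ℝ × ℝ) : ℝ :=
  α * (z.1 - z.2) ^ 2 + β * (z.1 + z.2 - 2 * p) ^ 2

/-- The set of all values `∫ f dμ`, `μ ∈ 𝒞_p`. -/
def objectiveValues (α β p : ℝ) : Set ℝ :=
  (fun μ : Measure (ℝ × ℝ) => ∫ z, quadObjective α β p z ∂μ) '' coherentSet p

/-- The set of optimal distributions: those `μ ∈ 𝒞_p` at which the maximum is attained. -/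
def maximizers (α β p : ℝ) : Set (Measure (ℝ × ℝ)) :=
  {μ | μ ∈ coherentSet p ∧ ∀ ν ∈ coherentSet p,
      ∫ z, quadObjective α β p z ∂ν ≤ ∫ z, quadObjective α β p z ∂μ}

/-- `μ` is a ladder distribution whose support has exactly `n` points. -/
def IsLadderDistribution (n : ℕ) (μ : Measure (ℝ × ℝ)) : Prop :=
  IsProbabilityMeasure μ ∧
  ∃ z : Fin n → ℝ × ℝ,
    μ.support = Set.range z ∧
    Function.Injective z ∧
    (Monotone (fun i => (z i).1) ∨ Antitone (fun i => (z i).1)) ∧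
    (Monotone (fun i => (z i).2) ∨ Antitone (fun i => (z i).2)) ∧
    (∀ i j : Fin n, (i : ℕ) + 1 = (j : ℕ) → (z i).1 = (z j).1 ∨ (z i).2 = (z j).2) ∧
    (∀ c : ℝ, {i | (z i).1 = c}.ncard ≤ 2) ∧
    (∀ c : ℝ, {i | (z i).2 = c}.ncard ≤ 2)

/-- First integrality condition. -/
def CondOne (α β p : ℝ) (N : ℕ) : Prop :=
  (α - β) / α = N ∧
    1 ≤ (2 - α / (α - β)) * p + α / (α - β) ∧ (2 - α / (α - β)) * p ≤ 1

/-- Second integrality condition. -/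
def CondTwo (α β p : ℝ) (N : ℕ) : Prop :=
  (2 * (α - β) - (α - 2 * β) * p) / α = N ∧ 1 < (2 - α / (α - β)) * p + α / (α - β)

/-- Third integrality condition. -/
def CondThree (α β p : ℝ) (N : ℕ) : Prop :=
  (2 * (α - β) - (α - 2 * β) * (1 - p)) / α = N ∧ (2 - α / (α - β)) * p < 1

/-!
Let `X` be the underlying Bernoulli variable, `X₁`, `X₂` the two conditional expectations, and
`c = α / (α - β)`. Since `E[Xᵢ²] = E[Xᵢ X]`, completing the square gives
`p (1 - p) α² / (α - β) - E f(X₁, X₂) = (α - β) E (X₁ + X₂ - 2p - c (X - p))²`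
(`IsCoherentPair.integral_quadObjective`). This is the upper bound. The case `α = 2β`, where the fully
informed pair `(X, X)` attains it, also settles the range `α ≤ 2β`. The maximum always exists, because
the laws of `(X, X₁, X₂)` form a weakly compact set (`exists_isGreatest_objectiveValues`).

The bound is attained exactly by the coherent distributions that live on the two lines
`x + y = A + c`, where `X = 1`, and `x + y = A`, where `X = 0`, with `A = (2 - c) p`. Read a point
`(x, y)` of the upper line as an edge from `1 - x` to `y`, of length `a = A + c - 1`, and a point of the
lower line as an edge from `y` to `1 - x`, of length `b = 1 - A`. Coherence then says that at every
`v ∈ [0, 1]` the mass arriving by edges of one kind and the mass leaving by edges of the other kind have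
the ratio `v : 1 - v` (`IsBalanced`). Mass can thus originate only at `0` and disappear only at `1`.
Since two consecutive steps have total length `c > 0`, the measure is determined by the two masses
leaving `0` by a step `a` or by a step `b` (`IsBalanced.eq_of_measure_zero_eq`), and such a mass can be
nonzero only if the walk `0, a, a + b, 2a + b, …`, or the one that starts with `b`, hits `1` before it
leaves `(0, 1)` (`IsBalanced.exists_isCompleteWalk`). Conversely every such walk of `n` steps carries an
optimal measure, whose points form a ladder with `n` points (`IsCompleteWalk.exists_isBalanced`). The
three integrality conditions express that a walk hits `1`: after an even number `2N` of steps, which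
concerns both walks at once, or after an odd number `2N - 1` of steps of the walk starting with `a`,
respectively with `b`.
-/

/-! ### Coherent distributions as pairs of measures -/

/-- `Y` is a calibrated forecast of an event whose complement carries the measure `P₀` and which
carries the measure `P₁`: given `Y = y`, the event has probability `y`. The identity is tested
against all nonnegative functions of `Y`; the forms `1 - Y` and `Y` are truncated at `0`, so that the
notion is meaningful only for `Y` with values in `[0, 1]`. -/
def IsCalibrated {Ω : Type*} [MeasurableSpace Ω] (P₀ P₁ : Measure Ω) (Y : Ω → ℝ) : Prop :=
  ∀ g : ℝ → ℝ≥0∞, Measurable g →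
    ∫⁻ ω, g (Y ω) * ENNReal.ofReal (1 - Y ω) ∂P₁ = ∫⁻ ω, g (Y ω) * ENNReal.ofReal (Y ω) ∂P₀

/-- The measures `μ₀`, `μ₁` on the unit square are the laws of `(X₁, X₂)` on `{X = 0}` and on
`{X = 1}`, for a pair `X₁`, `X₂` of calibrated forecasts of `{X = 1}`. The total mass is not
prescribed. -/
structure IsCoherentPair (μ₀ μ₁ : Measure (ℝ × ℝ)) : Prop where
  finite₀ : IsFiniteMeasure μ₀
  finite₁ : IsFiniteMeasure μ₁
  mem₀ : ∀ᵐ z ∂μ₀, z ∈ Set.Icc (0 : ℝ) 1 ×ˢ Set.Icc (0 : ℝ) 1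
  mem₁ : ∀ᵐ z ∂μ₁, z ∈ Set.Icc (0 : ℝ) 1 ×ˢ Set.Icc (0 : ℝ) 1
  fst : IsCalibrated μ₀ μ₁ Prod.fst
  snd : IsCalibrated μ₀ μ₁ Prod.snd

theorem isCalibrated_map {Ω : Type*} [MeasurableSpace Ω] {Y : Ω → ℝ} {Ω' : Type*} [MeasurableSpace Ω'] {T : Ω' → Ω} {Q₀ Q₁ : Measure Ω'}
    (hT : Measurable T) (hY : Measurable Y) :
    IsCalibrated (Q₀.map T) (Q₁.map T) Y ↔ IsCalibrated Q₀ Q₁ (Y ∘ T) := by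
  refine forall₂_congr fun g hg => ?_
  rw [lintegral_map (by fun_prop) hT, lintegral_map (by fun_prop) hT]
  rfl

theorem isCalibrated_iff_map_withDensity {Ω : Type*} [MeasurableSpace Ω] {P₀ P₁ : Measure Ω}
    {Y : Ω → ℝ} (hY : Measurable Y) :
    IsCalibrated P₀ P₁ Y ↔ (P₁.withDensity fun ω => ENNReal.ofReal (1 - Y ω)).map Y =
      (P₀.withDensity fun ω => ENNReal.ofReal (Y ω)).map Y := by
  have e : ∀ (P : Measure Ω) (f : Ω → ℝ≥0∞) (g : ℝ → ℝ≥0∞), Measurable f → Measurable g →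
      ∫⁻ y, g y ∂(P.withDensity f).map Y = ∫⁻ ω, g (Y ω) * f ω ∂P := by
    intro P f g hf hg
    rw [lintegral_map hg hY, lintegral_withDensity_eq_lintegral_mul _ hf (by fun_prop)]
    exact lintegral_congr fun ω => mul_comm _ _
  constructor
  · intro h
    refine Measure.ext_of_lintegral _ fun g hg => ?_
    rw [e _ _ _ (by fun_prop) hg, e _ _ _ (by fun_prop) hg, h g hg]
  · intro h g hg
    rw [← e _ _ _ (by fun_prop) hg, ← e _ _ _ (by fun_prop) hg, h]

/-- Indicator functions of events `{Y ∈ B}` suffice to test calibration. -/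
theorem isCalibrated_of_setLIntegral {Ω : Type*} [MeasurableSpace Ω] {P₀ P₁ : Measure Ω} {Y : Ω → ℝ}
    [IsFiniteMeasure P₀] [IsFiniteMeasure P₁] (hY : Measurable Y)
    (h : ∀ B, MeasurableSet B → ∫⁻ ω in Y ⁻¹' B, ENNReal.ofReal (1 - Y ω) ∂P₁ =
      ∫⁻ ω in Y ⁻¹' B, ENNReal.ofReal (Y ω) ∂P₀) : IsCalibrated P₀ P₁ Y := by
  rw [isCalibrated_iff_map_withDensity hY]
  ext B hB
  rw [Measure.map_apply hY hB, Measure.map_apply hY hB, withDensity_apply _ (hY hB),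
    withDensity_apply _ (hY hB), h B hB]

theorem ae_condExp_mem_Icc {Ω : Type*} {m mΩ : MeasurableSpace Ω} (P : Measure Ω) [IsProbabilityMeasure P]
    (hm : m ≤ mΩ) {X : Ω → ℝ} (hX : Measurable[mΩ] X) (h01 : ∀ᵐ ω ∂P, X ω = 0 ∨ X ω = 1) :
    ∀ᵐ ω ∂P, condExp m P X ω ∈ Set.Icc (0 : ℝ) 1 := by
  have hXi : Integrable X P := by
    refine Integrable.of_bound hX.aestronglyMeasurable 1 ?_
    filter_upwards [h01] with ω h
    rcases h with h | h <;> simp [h]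
  have h0 : 0 ≤ᵐ[P] condExp m P X := condExp_nonneg (by
    filter_upwards [h01] with ω h
    rcases h with h | h <;> simp [h])
  have h1 : condExp m P X ≤ᵐ[P] condExp m P fun _ => (1 : ℝ) :=
    condExp_mono hXi (integrable_const _) (by
      filter_upwards [h01] with ω h
      rcases h with h | h <;> simp [h])
  rw [condExp_const hm] at h1
  filter_upwards [h0, h1] with ω a b using ⟨a, b⟩

/-- A conditional probability is a calibrated forecast. -/
theorem isCalibrated_condExp {Ω : Type*} {m mΩ : MeasurableSpace Ω} (P : Measure Ω) [IsProbabilityMeasure P]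
    (hm : m ≤ mΩ) {X : Ω → ℝ} (hX : Measurable[mΩ] X) (h01 : ∀ᵐ ω ∂P, X ω = 0 ∨ X ω = 1) :
    IsCalibrated (P.restrict (X ⁻¹' {1})ᶜ) (P.restrict (X ⁻¹' {1})) (condExp m P X) := by
  have hE : MeasurableSet (X ⁻¹' {1}) := hX (measurableSet_singleton 1)
  have hXi : Integrable X P := by
    refine Integrable.of_bound hX.aestronglyMeasurable 1 ?_
    filter_upwards [h01] with ω h
    rcases h with h | h <;> simp [h]
  have hYm : Measurable[m] (condExp m P X) := stronglyMeasurable_condExp.measurable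
  have hY : Measurable[mΩ] (condExp m P X) := hYm.mono hm le_rfl
  have hI := ae_condExp_mem_Icc P hm hX h01
  refine isCalibrated_of_setLIntegral hY fun B hB => ?_
  have hS : MeasurableSet (condExp m P X ⁻¹' B) := hY hB
  set S := condExp m P X ⁻¹' B
  set Y := condExp m P X
  have hYi : Integrable Y P := integrable_condExp
  have e1 : ∫ ω in S, Y ω ∂P = ∫ ω in S, X ω ∂P := setIntegral_condExp hm hXi (hYm hB)
  have e2 : ∫ ω in S, X ω ∂P = ∫ ω in S, (X ⁻¹' {1}).indicator (fun _ => (1 : ℝ)) ω ∂P := by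
    refine integral_congr_ae (ae_restrict_of_ae ?_)
    filter_upwards [h01] with ω h
    rcases h with h | h <;> simp [Set.indicator, h]
  have e3 := integral_add_compl (μ := P.restrict S) hE hYi.integrableOn
  rw [integral_indicator hE] at e2
  rw [Measure.restrict_restrict hS, Measure.restrict_restrict hS, Set.inter_comm S,
    Set.inter_comm S, ← Measure.restrict_restrict hE, ← Measure.restrict_restrict hE.compl,
    ← ofReal_integral_eq_lintegral_ofReal, ← ofReal_integral_eq_lintegral_ofReal]
  · congr 1
    rw [integral_sub (integrable_const _) hYi.integrableOn.integrableOn]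
    linarith
  · exact hYi.integrableOn.integrableOn
  · exact ae_restrict_of_ae (ae_restrict_of_ae (hI.mono fun ω h => h.1))
  · exact (integrable_const _).sub hYi.integrableOn.integrableOn
  · exact ae_restrict_of_ae (ae_restrict_of_ae (hI.mono fun ω h => by simpa using h.2))

/-- For a calibrated forecast `Y` of an event carrying `P₁`, the integral of `Y` over a set defined
by `Y` is the probability of the event on that set. -/
theorem IsCalibrated.setIntegral_eq {Ω : Type*} [MeasurableSpace Ω] {P₀ P₁ : Measure Ω} {Y : Ω → ℝ}
    [IsFiniteMeasure P₀] [IsFiniteMeasure P₁]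
    (h : IsCalibrated P₀ P₁ Y) (hY : Measurable Y) (h0 : ∀ᵐ ω ∂P₀, Y ω ∈ Set.Icc (0 : ℝ) 1)
    (h1 : ∀ᵐ ω ∂P₁, Y ω ∈ Set.Icc (0 : ℝ) 1) {B : Set ℝ} (hB : MeasurableSet B) :
    ∫ ω in Y ⁻¹' B, Y ω ∂(P₀ + P₁) = P₁.real (Y ⁻¹' B) := by
  have hS := hY hB
  have e := h (B.indicator 1) (measurable_one.indicator hB)
  have e' : ∀ ω, ∀ c : ℝ≥0∞, B.indicator (1 : ℝ → ℝ≥0∞) (Y ω) * c =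
      (Y ⁻¹' B).indicator (fun _ => c) ω := by
    intro ω c
    by_cases hω : Y ω ∈ B <;> simp [Set.indicator, hω]
  have e0 : ∀ (P : Measure Ω) (f : Ω → ℝ≥0∞),
      ∫⁻ ω, B.indicator (1 : ℝ → ℝ≥0∞) (Y ω) * f ω ∂P = ∫⁻ ω in Y ⁻¹' B, f ω ∂P := by
    intro P f
    rw [← lintegral_indicator hS]
    refine lintegral_congr fun ω => ?_
    by_cases hω : Y ω ∈ B <;> simp [Set.indicator, hω]
  rw [e0, e0] at e
  rw [integral_eq_lintegral_of_nonneg_ae, Measure.restrict_add, lintegral_add_measure, ← e,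
    ← lintegral_add_left (by fun_prop), measureReal_def]
  · congr 1
    rw [← setLIntegral_one]
    refine lintegral_congr_ae (ae_restrict_of_ae ?_)
    filter_upwards [h1] with ω hω
    rw [← ENNReal.ofReal_add (by linarith [hω.2]) hω.1]
    simp
  · refine ae_restrict_of_ae ?_
    exact ae_add_measure_iff.2 ⟨h0.mono fun ω h => h.1, h1.mono fun ω h => h.1⟩
  · exact hY.aestronglyMeasurable

theorem exists_isCoherentPair_of_mem_coherentSet {p : ℝ} {μ : Measure (ℝ × ℝ)}
    (h : μ ∈ coherentSet p) : ∃ μ₀ μ₁, IsCoherentPair μ₀ μ₁ ∧ μ = μ₀ + μ₁ ∧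
      IsProbabilityMeasure μ ∧ μ₁.real Set.univ = p := by
  obtain ⟨Ω, m₁, m₂, mΩ, P, X, hP, hX, h01, hp, h1, h2, rfl⟩ := h
  have hE : MeasurableSet (X ⁻¹' {1}) := hX (measurableSet_singleton 1)
  have hY1 : Measurable[mΩ] (condExp m₁ P X) :=
    stronglyMeasurable_condExp.measurable.mono h1 le_rfl
  have hY2 : Measurable[mΩ] (condExp m₂ P X) :=
    stronglyMeasurable_condExp.measurable.mono h2 le_rfl
  have hT : Measurable[mΩ] (fun ω => (condExp m₁ P X ω, condExp m₂ P X ω)) := hY1.prodMk hY2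
  set T := fun ω => (condExp m₁ P X ω, condExp m₂ P X ω)
  have hI : ∀ᵐ ω ∂P, T ω ∈ Set.Icc (0 : ℝ) 1 ×ˢ Set.Icc (0 : ℝ) 1 := by
    filter_upwards [ae_condExp_mem_Icc P h1 hX h01, ae_condExp_mem_Icc P h2 hX h01] with ω a b
      using ⟨a, b⟩
  have hsq : MeasurableSet (Set.Icc (0 : ℝ) 1 ×ˢ Set.Icc (0 : ℝ) 1) :=
    measurableSet_Icc.prod measurableSet_Icc
  refine ⟨(P.restrict (X ⁻¹' {1})ᶜ).map T, (P.restrict (X ⁻¹' {1})).map T,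
    ⟨inferInstance, inferInstance, ?_, ?_, ?_, ?_⟩, ?_, Measure.isProbabilityMeasure_map
      hT.aemeasurable, ?_⟩
  · exact (mem_ae_map_iff hT.aemeasurable hsq).2 (ae_restrict_of_ae hI)
  · exact (mem_ae_map_iff hT.aemeasurable hsq).2 (ae_restrict_of_ae hI)
  · rw [isCalibrated_map hT measurable_fst]
    exact isCalibrated_condExp P h1 hX h01
  · rw [isCalibrated_map hT measurable_snd]
    exact isCalibrated_condExp P h2 hX h01
  · rw [← Measure.map_add _ _ hT, add_comm, Measure.restrict_add_restrict_compl hE]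
  · rw [measureReal_def, Measure.map_apply hT MeasurableSet.univ, Set.preimage_univ,
      Measure.restrict_apply_univ, ← measureReal_def, ← hp, ← integral_indicator_one hE]
    refine integral_congr_ae ?_
    filter_upwards [h01] with ω h
    rcases h with h | h <;> simp [Set.indicator, h]

/-- The converse of `exists_isCoherentPair_of_mem_coherentSet`: on `ℝ × (ℝ × ℝ)` with the law of
`(X, X₁, X₂)`, the coordinates `X₁`, `X₂` are the conditional expectations of `X` given the
σ-algebras that they generate. -/
theorem IsCoherentPair.add_mem_coherentSet {μ₀ μ₁ : Measure (ℝ × ℝ)} (h : IsCoherentPair μ₀ μ₁)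
    (hprob : IsProbabilityMeasure (μ₀ + μ₁)) :
    μ₀ + μ₁ ∈ coherentSet (μ₁.real Set.univ) := by
  have := h.finite₀
  have := h.finite₁
  have hj : ∀ x : ℝ, Measurable (fun z : ℝ × ℝ => (x, z)) := fun x => by fun_prop
  set P₀ : Measure (ℝ × ℝ × ℝ) := μ₀.map (fun z => (0, z)) with hP₀
  set P₁ : Measure (ℝ × ℝ × ℝ) := μ₁.map (fun z => (1, z)) with hP₁
  have hsum : (P₀ + P₁).map Prod.snd = μ₀ + μ₁ := by
    rw [Measure.map_add _ _ measurable_snd, hP₀, hP₁, Measure.map_map measurable_snd (hj 0),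
      Measure.map_map measurable_snd (hj 1)]
    simp [Function.comp_def]
  have hP : IsProbabilityMeasure (P₀ + P₁) := by
    constructor
    have := congrArg (fun ν => ν Set.univ) hsum
    simp only [Measure.map_apply measurable_snd MeasurableSet.univ, measure_univ] at this
    simpa using this
  have hX0 : ∀ᵐ ω ∂P₀, ω.1 = 0 := by
    rw [hP₀, ae_map_iff (hj 0).aemeasurable (measurableSet_eq_fun measurable_fst measurable_const)]
    simp
  have hX1 : ∀ᵐ ω ∂P₁, ω.1 = 1 := by
    rw [hP₁, ae_map_iff (hj 1).aemeasurable (measurableSet_eq_fun measurable_fst measurable_const)]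
    simp
  have hXi0 : Integrable (fun ω : ℝ × ℝ × ℝ => ω.1) P₀ :=
    (integrable_zero _ _ _).congr (hX0.mono fun ω h => h.symm)
  have hXi1 : Integrable (fun ω : ℝ × ℝ × ℝ => ω.1) P₁ :=
    (integrable_const (1 : ℝ)).congr (hX1.mono fun ω h => h.symm)
  have hXS : ∀ S, MeasurableSet S → ∫ ω in S, ω.1 ∂(P₀ + P₁) = P₁.real S := by
    intro S hS
    rw [Measure.restrict_add, integral_add_measure hXi0.integrableOn hXi1.integrableOn,
      integral_congr_ae (ae_restrict_of_ae hX0), integral_congr_ae (ae_restrict_of_ae hX1)]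
    simp
  have key : ∀ Y : ℝ × ℝ → ℝ, Measurable Y → IsCalibrated μ₀ μ₁ Y →
      (∀ᵐ z ∂μ₀, Y z ∈ Set.Icc (0 : ℝ) 1) → (∀ᵐ z ∂μ₁, Y z ∈ Set.Icc (0 : ℝ) 1) →
      (fun ω => Y ω.2) =ᵐ[P₀ + P₁]
        condExp (MeasurableSpace.comap (fun ω : ℝ × ℝ × ℝ => Y ω.2) inferInstance) (P₀ + P₁)
          (fun ω => ω.1) := by
    intro Y hY hcal hm0 hm1
    have hY2 : Measurable (fun ω : ℝ × ℝ × ℝ => Y ω.2) := by fun_prop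
    have c0 : ∀ᵐ ω ∂P₀, Y ω.2 ∈ Set.Icc (0 : ℝ) 1 := by
      rw [hP₀, ae_map_iff (hj 0).aemeasurable (hY2 measurableSet_Icc)]
      exact hm0
    have c1 : ∀ᵐ ω ∂P₁, Y ω.2 ∈ Set.Icc (0 : ℝ) 1 := by
      rw [hP₁, ae_map_iff (hj 1).aemeasurable (hY2 measurableSet_Icc)]
      exact hm1
    have hc : IsCalibrated P₀ P₁ (fun ω => Y ω.2) := by
      intro g hg
      rw [hP₀, hP₁, lintegral_map (by fun_prop) (hj 0), lintegral_map (by fun_prop) (hj 1)]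
      exact hcal g hg
    have hYi : Integrable (fun ω => Y ω.2) (P₀ + P₁) := by
      refine Integrable.of_bound hY2.aestronglyMeasurable 1 ?_
      rw [ae_add_measure_iff]
      exact ⟨c0.mono fun ω h => by rw [Real.norm_eq_abs, abs_le]; constructor <;> linarith [h.1, h.2],
        c1.mono fun ω h => by rw [Real.norm_eq_abs, abs_le]; constructor <;> linarith [h.1, h.2]⟩
    refine ae_eq_condExp_of_forall_setIntegral_eq hY2.comap_le (hXi0.add_measure hXi1)
      (fun s _ _ => hYi.integrableOn) ?_ ?_
    · rintro _ ⟨B, hB, rfl⟩ -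
      rw [hXS _ (hY2 hB), hc.setIntegral_eq hY2 c0 c1 hB]
    · exact (comap_measurable _).aestronglyMeasurable
  have k1 := key Prod.fst measurable_fst h.fst (h.mem₀.mono fun z h => h.1)
    (h.mem₁.mono fun z h => h.1)
  have k2 := key Prod.snd measurable_snd h.snd (h.mem₀.mono fun z h => h.2)
    (h.mem₁.mono fun z h => h.2)
  refine ⟨ℝ × ℝ × ℝ, _, _, inferInstance, P₀ + P₁, fun ω => ω.1, hP, measurable_fst, ?_, ?_,
    Measurable.comap_le (f := fun ω : ℝ × ℝ × ℝ => ω.2.1) (by fun_prop),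
    Measurable.comap_le (f := fun ω : ℝ × ℝ × ℝ => ω.2.2) (by fun_prop), ?_⟩
  · rw [ae_add_measure_iff]
    exact ⟨hX0.mono fun ω h => Or.inl h, hX1.mono fun ω h => Or.inr h⟩
  · have := hXS Set.univ MeasurableSet.univ
    rw [Measure.restrict_univ] at this
    rw [this, measureReal_def, hP₁, Measure.map_apply (hj 1) MeasurableSet.univ,
      Set.preimage_univ, measureReal_def]
  · rw [← hsum]
    refine Measure.map_congr ?_
    filter_upwards [k1, k2] with ω a b
    exact Prod.ext a b

/-! ### Existence of a maximum -/

/-- No integrability of `φ` is needed: both sides are integrals of `φ` against the same measure. -/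
theorem IsCalibrated.integral_eq {Ω : Type*} [MeasurableSpace Ω] {P₀ P₁ : Measure Ω} {Y : Ω → ℝ}
    (h : IsCalibrated P₀ P₁ Y) (hY : Measurable Y) (h0 : ∀ᵐ ω ∂P₀, Y ω ∈ Set.Icc (0 : ℝ) 1)
    (h1 : ∀ᵐ ω ∂P₁, Y ω ∈ Set.Icc (0 : ℝ) 1) {φ : ℝ → ℝ} (hφ : Measurable φ) :
    ∫ ω, φ (Y ω) * (1 - Y ω) ∂P₁ = ∫ ω, φ (Y ω) * Y ω ∂P₀ := by
  have := congrArg (fun ν => ∫ y, φ y ∂ν) ((isCalibrated_iff_map_withDensity hY).1 h)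
  simp only [integral_map hY.aemeasurable hφ.aestronglyMeasurable] at this
  rw [integral_withDensity_eq_integral_toReal_smul (by fun_prop) (by simp),
    integral_withDensity_eq_integral_toReal_smul (by fun_prop) (by simp)] at this
  convert this using 1
  · refine integral_congr_ae ?_
    filter_upwards [h1] with ω hω
    rw [ENNReal.toReal_ofReal (by linarith [hω.2]), smul_eq_mul, mul_comm]
  · refine integral_congr_ae ?_
    filter_upwards [h0] with ω hω
    rw [ENNReal.toReal_ofReal hω.1, smul_eq_mul, mul_comm]

theorem isCalibrated_of_integral_eq {Ω : Type*} [MeasurableSpace Ω] {P₀ P₁ : Measure Ω}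
    [IsFiniteMeasure P₀] [IsFiniteMeasure P₁] {Y : Ω → ℝ} (hY : Measurable Y)
    (hI : ∀ ω, Y ω ∈ Set.Icc (0 : ℝ) 1)
    (h : ∀ φ : BoundedContinuousFunction ℝ ℝ,
      ∫ ω, φ (Y ω) * (1 - Y ω) ∂P₁ = ∫ ω, φ (Y ω) * Y ω ∂P₀) : IsCalibrated P₀ P₁ Y := by
  rw [isCalibrated_iff_map_withDensity hY]
  have fin : ∀ (P : Measure Ω) (f : Ω → ℝ), IsFiniteMeasure P → (∀ ω, f ω ≤ 1) →
      IsFiniteMeasure (P.withDensity fun ω => ENNReal.ofReal (f ω)) := by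
    intro P f hP hf
    refine isFiniteMeasure_withDensity (ne_of_lt ?_)
    refine (lintegral_mono (g := fun _ => (1 : ℝ≥0∞)) fun ω => ?_).trans_lt (by simp)
    simpa using ENNReal.ofReal_le_ofReal (hf ω)
  have := fin P₁ (fun ω => 1 - Y ω) inferInstance fun ω => by linarith [(hI ω).1]
  have := fin P₀ Y inferInstance fun ω => (hI ω).2
  refine ext_of_forall_integral_eq_of_IsFiniteMeasure fun φ => ?_
  have hφ : Measurable φ := φ.continuous.measurable
  rw [integral_map hY.aemeasurable hφ.aestronglyMeasurable,
    integral_map hY.aemeasurable hφ.aestronglyMeasurable,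
    integral_withDensity_eq_integral_toReal_smul (by fun_prop) (by simp),
    integral_withDensity_eq_integral_toReal_smul (by fun_prop) (by simp)]
  convert h φ using 1
  · refine integral_congr_ae (.of_forall fun ω => ?_)
    dsimp only
    rw [ENNReal.toReal_ofReal (by linarith [(hI ω).2]), smul_eq_mul, mul_comm]
  · refine integral_congr_ae (.of_forall fun ω => ?_)
    dsimp only
    rw [ENNReal.toReal_ofReal (hI ω).1, smul_eq_mul, mul_comm]

/-- The law of `(X, X₁, X₂)` lives on this compact space, `true` standing for `X = 1`. -/
abbrev ForecastSpace : Type := Bool × unitInterval × unitInterval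

/-- The outcome `X` as a function on `ForecastSpace`. -/
def outcome (k : ForecastSpace) : ℝ := if k.1 then 1 else 0

theorem continuous_outcome : Continuous outcome :=
  (continuous_of_discreteTopology (f := fun b : Bool => if b then (1 : ℝ) else 0)).comp
    continuous_fst

/-- The laws of `(X, X₁, X₂)` for which `X₁`, `X₂` are conditional expectations of `X` and `X` has
mean `p`. Calibration is tested on continuous functions, which makes the set weakly closed. -/
def coherentLaws (p : ℝ) : Set (ProbabilityMeasure ForecastSpace) :=
  {π | ∫ k, outcome k ∂(π : Measure ForecastSpace) = p ∧
    ∀ φ : BoundedContinuousFunction ℝ ℝ,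
      ∫ k, φ k.2.1 * (outcome k - k.2.1) ∂(π : Measure ForecastSpace) = 0 ∧
      ∫ k, φ k.2.2 * (outcome k - k.2.2) ∂(π : Measure ForecastSpace) = 0}

theorem continuous_integral_probabilityMeasure {K : Type*} [TopologicalSpace K] [CompactSpace K]
    [MeasurableSpace K] [OpensMeasurableSpace K] {h : K → ℝ} (hh : Continuous h) :
    Continuous fun π : ProbabilityMeasure K => ∫ k, h k ∂(π : Measure K) :=
  ProbabilityMeasure.continuous_integral_boundedContinuousFunction
    (BoundedContinuousFunction.mkOfCompact ⟨h, hh⟩)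

theorem isClosed_coherentLaws (p : ℝ) : IsClosed (coherentLaws p) := by
  have hc := continuous_outcome
  have : coherentLaws p =
      {π : ProbabilityMeasure ForecastSpace | ∫ k, outcome k ∂(π : Measure ForecastSpace) = p} ∩
      ⋂ φ : BoundedContinuousFunction ℝ ℝ,
        {π : ProbabilityMeasure ForecastSpace |
          ∫ k, φ k.2.1 * (outcome k - k.2.1) ∂(π : Measure ForecastSpace) = 0} ∩
        {π : ProbabilityMeasure ForecastSpace |
          ∫ k, φ k.2.2 * (outcome k - k.2.2) ∂(π : Measure ForecastSpace) = 0} := by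
    ext π
    simp [coherentLaws]
  rw [this]
  refine (isClosed_eq (continuous_integral_probabilityMeasure hc) continuous_const).inter
    (isClosed_iInter fun φ => ?_)
  have hφ := φ.continuous
  exact (isClosed_eq (continuous_integral_probabilityMeasure (by fun_prop)) continuous_const).inter
    (isClosed_eq (continuous_integral_probabilityMeasure (by fun_prop)) continuous_const)

theorem continuous_quadObjective (α β p : ℝ) : Continuous (quadObjective α β p) := by
  unfold quadObjective
  fun_prop

theorem integrable_forecastSpace {h : ForecastSpace → ℝ} (hh : Continuous h)
    (π : Measure ForecastSpace) [IsFiniteMeasure π] : Integrable h π :=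
  (BoundedContinuousFunction.mkOfCompact ⟨h, hh⟩).integrable π

/-- Every element of `coherentLaws p` induces a coherent distribution. -/
theorem map_mem_coherentSet {p : ℝ} {π : ProbabilityMeasure ForecastSpace}
    (hπ : π ∈ coherentLaws p) :
    (π : Measure ForecastSpace).map (fun k => ((k.2.1 : ℝ), (k.2.2 : ℝ))) ∈ coherentSet p := by
  obtain ⟨hp, hcal⟩ := hπ
  set Q : Measure ForecastSpace := (π : Measure ForecastSpace)
  have hc := continuous_outcome
  have hE : MeasurableSet {k : ForecastSpace | k.1 = true} :=
    measurable_fst (measurableSet_singleton true)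
  set E := {k : ForecastSpace | k.1 = true}
  have hT : Measurable (fun k : ForecastSpace => ((k.2.1 : ℝ), (k.2.2 : ℝ))) := by fun_prop
  set T := fun k : ForecastSpace => ((k.2.1 : ℝ), (k.2.2 : ℝ))
  have hE1 : ∀ k ∈ E, outcome k = 1 := fun k hk => if_pos hk
  have hE0 : ∀ k ∈ Eᶜ, outcome k = 0 := fun k hk => if_neg hk
  have hsq : MeasurableSet (Set.Icc (0 : ℝ) 1 ×ˢ Set.Icc (0 : ℝ) 1) :=
    measurableSet_Icc.prod measurableSet_Icc
  have cal : ∀ Y : ForecastSpace → ℝ, Continuous Y → (∀ k, Y k ∈ Set.Icc (0 : ℝ) 1) →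
      (∀ φ : BoundedContinuousFunction ℝ ℝ, ∫ k, φ (Y k) * (outcome k - Y k) ∂Q = 0) →
      IsCalibrated (Q.restrict Eᶜ) (Q.restrict E) Y := by
    intro Y hY hI h
    refine isCalibrated_of_integral_eq hY.measurable hI fun φ => ?_
    have hφ := φ.continuous
    have hint : Integrable (fun k => φ (Y k) * (outcome k - Y k)) Q :=
      integrable_forecastSpace (by fun_prop) Q
    have e := integral_add_compl hE hint
    rw [h φ, setIntegral_congr_fun (g := fun k => φ (Y k) * (1 - Y k)) hE
      (fun k hk => by simp only [hE1 k hk]), setIntegral_congr_fun (g := fun k => -(φ (Y k) * Y k))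
      hE.compl (fun k hk => by simp only [hE0 k hk]; ring), integral_neg] at e
    linarith
  have hpair : IsCoherentPair ((Q.restrict Eᶜ).map T) ((Q.restrict E).map T) := by
    refine ⟨inferInstance, inferInstance, (mem_ae_map_iff hT.aemeasurable hsq).2
      (Filter.Eventually.of_forall fun k => ⟨k.2.1.2, k.2.2.2⟩), (mem_ae_map_iff hT.aemeasurable hsq).2
      (Filter.Eventually.of_forall fun k => ⟨k.2.1.2, k.2.2.2⟩), ?_, ?_⟩
    · rw [isCalibrated_map hT measurable_fst]
      exact cal _ (by fun_prop) (fun k => k.2.1.2) fun φ => (hcal φ).1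
    · rw [isCalibrated_map hT measurable_snd]
      exact cal _ (by fun_prop) (fun k => k.2.2.2) fun φ => (hcal φ).2
  have hsum : (Q.restrict Eᶜ).map T + (Q.restrict E).map T = Q.map T := by
    rw [← Measure.map_add _ _ hT, add_comm, Measure.restrict_add_restrict_compl hE]
  have hprob : IsProbabilityMeasure (Q.map T) := Measure.isProbabilityMeasure_map hT.aemeasurable
  have := hpair.add_mem_coherentSet (by rw [hsum]; exact hprob)
  rw [hsum] at this
  convert this using 1
  congr 1
  rw [measureReal_def, Measure.map_apply hT MeasurableSet.univ, Set.preimage_univ,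
    Measure.restrict_apply_univ, ← measureReal_def, ← hp, ← integral_indicator_one hE]
  refine integral_congr_ae (.of_forall fun k => ?_)
  by_cases hk : k ∈ E
  · simp [hk, hE1 k hk]
  · simp [hk, hE0 k hk]

/-- Every coherent distribution comes from an element of `coherentLaws p`. -/
theorem exists_mem_coherentLaws {p : ℝ} {μ : Measure (ℝ × ℝ)} (hμ : μ ∈ coherentSet p) :
    ∃ π ∈ coherentLaws p, ∀ f : ℝ × ℝ → ℝ, Continuous f →
      ∫ k, f ((k.2.1 : ℝ), (k.2.2 : ℝ)) ∂(π : Measure ForecastSpace) = ∫ z, f z ∂μ := by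
  obtain ⟨μ₀, μ₁, h, rfl, hprob, hp⟩ := exists_isCoherentPair_of_mem_coherentSet hμ
  have := h.finite₀
  have := h.finite₁
  have h01 : (0 : ℝ) ≤ 1 := zero_le_one
  set j : Bool → ℝ × ℝ → ForecastSpace :=
    fun b z => (b, Set.projIcc 0 1 h01 z.1, Set.projIcc 0 1 h01 z.2) with hj
  have hjm : ∀ b, Measurable (j b) := fun b => by
    have : Continuous (j b) := by
      have := continuous_projIcc (h := h01)
      fun_prop
    exact this.measurable
  set Q : Measure ForecastSpace := μ₀.map (j false) + μ₁.map (j true) with hQ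
  have hQp : IsProbabilityMeasure Q := by
    constructor
    rw [hQ, Measure.add_apply, Measure.map_apply (hjm _) MeasurableSet.univ,
      Measure.map_apply (hjm _) MeasurableSet.univ, Set.preimage_univ, Set.preimage_univ,
      ← Measure.add_apply, measure_univ]
  have hc := continuous_outcome
  have int : ∀ F : ForecastSpace → ℝ, Continuous F →
      ∫ k, F k ∂Q = ∫ z, F (j false z) ∂μ₀ + ∫ z, F (j true z) ∂μ₁ := by
    intro F hF
    rw [hQ, integral_add_measure (integrable_forecastSpace hF _) (integrable_forecastSpace hF _),
      integral_map (hjm _).aemeasurable hF.aestronglyMeasurable,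
      integral_map (hjm _).aemeasurable hF.aestronglyMeasurable]
  have proj : ∀ x : ℝ, x ∈ Set.Icc (0 : ℝ) 1 → ((Set.projIcc 0 1 h01 x : unitInterval) : ℝ) = x :=
    fun x hx => by rw [Set.projIcc_of_mem h01 hx]
  have cal : ∀ (Y : ForecastSpace → ℝ) (y : ℝ × ℝ → ℝ), Continuous Y → Measurable y →
      (∀ᵐ z ∂μ₀, y z ∈ Set.Icc (0 : ℝ) 1) → (∀ᵐ z ∂μ₁, y z ∈ Set.Icc (0 : ℝ) 1) →
      (∀ b z, Y (j b z) = Set.projIcc 0 1 h01 (y z)) → IsCalibrated μ₀ μ₁ y →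
      ∀ φ : BoundedContinuousFunction ℝ ℝ, ∫ k, φ (Y k) * (outcome k - Y k) ∂Q = 0 := by
    intro Y y hY hy hy0 hy1 hYy hcal φ
    have hφ := φ.continuous
    rw [int _ (by fun_prop)]
    have e := hcal.integral_eq hy hy0 hy1 hφ.measurable
    have e1 : ∫ z, φ (Y (j true z)) * (outcome (j true z) - Y (j true z)) ∂μ₁ =
        ∫ z, φ (y z) * (1 - y z) ∂μ₁ := by
      refine integral_congr_ae ?_
      filter_upwards [hy1] with z hz
      rw [hYy, proj _ hz]
      simp [outcome, hj]
    have e0 : ∫ z, φ (Y (j false z)) * (outcome (j false z) - Y (j false z)) ∂μ₀ =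
        ∫ z, -(φ (y z) * y z) ∂μ₀ := by
      refine integral_congr_ae ?_
      filter_upwards [hy0] with z hz
      rw [hYy, proj _ hz]
      simp [outcome, hj]
    rw [e1, e0, integral_neg]
    linarith
  refine ⟨⟨Q, hQp⟩, ⟨?_, fun φ => ⟨?_, ?_⟩⟩, fun f hf => ?_⟩
  · change ∫ k, outcome k ∂Q = p
    rw [int _ hc]
    simpa [outcome, hj] using hp
  · exact cal (fun k => k.2.1) Prod.fst (by fun_prop) measurable_fst (h.mem₀.mono fun z h => h.1)
      (h.mem₁.mono fun z h => h.1) (fun b z => rfl) h.fst φ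
  · exact cal (fun k => k.2.2) Prod.snd (by fun_prop) measurable_snd (h.mem₀.mono fun z h => h.2)
      (h.mem₁.mono fun z h => h.2) (fun b z => rfl) h.snd φ
  · change ∫ k, f ((k.2.1 : ℝ), (k.2.2 : ℝ)) ∂Q = _
    rw [int (fun k => f ((k.2.1 : ℝ), (k.2.2 : ℝ))) (by fun_prop)]
    have e : ∀ ν : Measure (ℝ × ℝ), ∀ b,
        (∀ᵐ z ∂ν, z ∈ Set.Icc (0 : ℝ) 1 ×ˢ Set.Icc (0 : ℝ) 1) →
        (fun z => f (((j b z).2.1 : ℝ), ((j b z).2.2 : ℝ))) =ᵐ[ν] f := by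
      intro ν b hν
      filter_upwards [hν] with z hz
      simp only [hj]
      rw [proj _ hz.1, proj _ hz.2]
    have bd : ∀ ν : Measure (ℝ × ℝ), IsFiniteMeasure ν → ∀ b,
        Integrable (fun z => f (((j b z).2.1 : ℝ), ((j b z).2.2 : ℝ))) ν := by
      intro ν _ b
      exact (integrable_forecastSpace (h := fun k => f ((k.2.1 : ℝ), (k.2.2 : ℝ)))
        (by fun_prop) (ν.map (j b))).comp_measurable (hjm b)
    rw [integral_congr_ae (e μ₀ false h.mem₀), integral_congr_ae (e μ₁ true h.mem₁),
      integral_add_measure ((bd μ₀ inferInstance false).congr (e μ₀ false h.mem₀))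
        ((bd μ₁ inferInstance true).congr (e μ₁ true h.mem₁))]

theorem exists_isGreatest_objectiveValues (α β : ℝ) {p : ℝ} (hne : (coherentSet p).Nonempty) :
    ∃ M, IsGreatest (objectiveValues α β p) M := by
  have hq := continuous_quadObjective α β p
  have hT : Measurable (fun k : ForecastSpace => ((k.2.1 : ℝ), (k.2.2 : ℝ))) := by fun_prop
  obtain ⟨μ, hμ⟩ := hne
  obtain ⟨π, hπ, -⟩ := exists_mem_coherentLaws hμ
  obtain ⟨π', hπ', hmax⟩ := (isClosed_coherentLaws p).isCompact.exists_isMaxOn ⟨π, hπ⟩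
    (continuous_integral_probabilityMeasure
      (h := fun k : ForecastSpace => quadObjective α β p ((k.2.1 : ℝ), (k.2.2 : ℝ)))
      (by fun_prop)).continuousOn
  refine ⟨_, ⟨_, map_mem_coherentSet hπ', rfl⟩, ?_⟩
  rintro _ ⟨ν, hν, rfl⟩
  obtain ⟨π'', h'', hint⟩ := exists_mem_coherentLaws hν
  dsimp only
  rw [← hint _ hq, integral_map hT.aemeasurable hq.aestronglyMeasurable]
  exact hmax h''

/-! ### The deficit of a coherent distribution -/

theorem integrable_of_ae_mem_unitSquare {ν : Measure (ℝ × ℝ)} [IsFiniteMeasure ν]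
    (hν : ∀ᵐ z ∂ν, z ∈ Set.Icc (0 : ℝ) 1 ×ˢ Set.Icc (0 : ℝ) 1) {f : ℝ × ℝ → ℝ}
    (hf : Continuous f) : Integrable f ν := by
  rw [← Measure.restrict_eq_self_of_ae_mem hν]
  exact hf.continuousOn.integrableOn_compact (isCompact_Icc.prod isCompact_Icc)

/-- The distance to the bound is the integral of `(α - β) (X₁ + X₂ - 2p - c (X - p))²`, where
`c = α / (α - β)`. The linear functions `2α (x - p)` of the single forecasts are the multipliers of
the calibration constraints. -/
theorem IsCoherentPair.integral_quadObjective {μ₀ μ₁ : Measure (ℝ × ℝ)} (h : IsCoherentPair μ₀ μ₁)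
    (hprob : IsProbabilityMeasure (μ₀ + μ₁)) {p : ℝ} (hp : μ₁.real Set.univ = p) {α β : ℝ}
    (hαβ : α ≠ β) :
    ∫ z, quadObjective α β p z ∂(μ₀ + μ₁) = p * (1 - p) * (α ^ 2 / (α - β)) - (α - β) *
      (∫ z, (z.1 + z.2 - (2 - α / (α - β)) * p) ^ 2 ∂μ₀ +
        ∫ z, (z.1 + z.2 - ((2 - α / (α - β)) * p + α / (α - β))) ^ 2 ∂μ₁) := by
  have := h.finite₀
  have := h.finite₁
  have hp0 : μ₀.real Set.univ = 1 - p := by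
    have : (μ₀ + μ₁).real Set.univ = 1 := by simp
    rw [measureReal_add_apply] at this
    linarith
  have hq := continuous_quadObjective α β p
  have hne : α - β ≠ 0 := sub_ne_zero.2 hαβ
  have i0 : ∀ {f : ℝ × ℝ → ℝ}, Continuous f → Integrable f μ₀ := fun hf =>
    integrable_of_ae_mem_unitSquare h.mem₀ hf
  have i1 : ∀ {f : ℝ × ℝ → ℝ}, Continuous f → Integrable f μ₁ := fun hf =>
    integrable_of_ae_mem_unitSquare h.mem₁ hf
  set c := α / (α - β) with hc
  have hcα : (α - β) * c = α := by rw [hc]; field_simp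
  have hbound : α ^ 2 / (α - β) = (α - β) * c ^ 2 := by rw [hc]; field_simp
  set A := (2 - c) * p with hA
  have e1 := h.fst.integral_eq measurable_fst (h.mem₀.mono fun z h => h.1)
    (h.mem₁.mono fun z h => h.1) (φ := fun t => 2 * α * (t - p)) (by fun_prop)
  have e2 := h.snd.integral_eq measurable_snd (h.mem₀.mono fun z h => h.2)
    (h.mem₁.mono fun z h => h.2) (φ := fun t => 2 * α * (t - p)) (by fun_prop)
  have d0 : ∫ z, quadObjective α β p z ∂μ₀ = ∫ z, ((((4 * β * p ^ 2 + (α - β) * A ^ 2) -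
      (α - β) * (z.1 + z.2 - A) ^ 2) + 2 * α * (z.1 - p) * z.1) +
        2 * α * (z.2 - p) * z.2) ∂μ₀ := by
    refine integral_congr_ae (.of_forall fun z => ?_)
    simp only [quadObjective, hA]
    linear_combination (2 * p * (z.1 + z.2)) * hcα
  have d1 : ∫ z, quadObjective α β p z ∂μ₁ = ∫ z, ((((4 * β * (1 - p) ^ 2 +
      (α - β) * (2 - (A + c)) ^ 2) - (α - β) * (z.1 + z.2 - (A + c)) ^ 2) -
        2 * α * (z.1 - p) * (1 - z.1)) - 2 * α * (z.2 - p) * (1 - z.2)) ∂μ₁ := by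
    refine integral_congr_ae (.of_forall fun z => ?_)
    simp only [quadObjective, hA]
    linear_combination (-(2 * (1 - p) * (z.1 + z.2)) + 4 * (1 - p)) * hcα
  rw [integral_add (i0 (by fun_prop)) (i0 (by fun_prop)),
    integral_add (i0 (by fun_prop)) (i0 (by fun_prop)),
    integral_sub (i0 (by fun_prop)) (i0 (by fun_prop)), integral_const, integral_const_mul,
    hp0, smul_eq_mul] at d0
  rw [integral_sub (i1 (by fun_prop)) (i1 (by fun_prop)),
    integral_sub (i1 (by fun_prop)) (i1 (by fun_prop)),
    integral_sub (i1 (by fun_prop)) (i1 (by fun_prop)), integral_const, integral_const_mul,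
    hp, smul_eq_mul] at d1
  rw [integral_add_measure (i0 hq) (i1 hq), d0, d1, hbound, ← e1, ← e2, hA]
  linear_combination (-4*p*(1-p)) * hcα

theorem IsCoherentPair.integral_quadObjective_le {μ₀ μ₁ : Measure (ℝ × ℝ)}
    (h : IsCoherentPair μ₀ μ₁) (hprob : IsProbabilityMeasure (μ₀ + μ₁)) {p : ℝ}
    (hp : μ₁.real Set.univ = p) {α β : ℝ} (hαβ : β < α) :
    ∫ z, quadObjective α β p z ∂(μ₀ + μ₁) ≤ p * (1 - p) * (α ^ 2 / (α - β)) := by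
  rw [h.integral_quadObjective hprob hp hαβ.ne']
  have h0 : 0 ≤ ∫ z, (z.1 + z.2 - (2 - α / (α - β)) * p) ^ 2 ∂μ₀ :=
    integral_nonneg fun z => sq_nonneg _
  have h1 : 0 ≤ ∫ z, (z.1 + z.2 - ((2 - α / (α - β)) * p + α / (α - β))) ^ 2 ∂μ₁ :=
    integral_nonneg fun z => sq_nonneg _
  nlinarith [mul_nonneg (sub_pos.2 hαβ).le (add_nonneg h0 h1)]

/-- The bound is attained exactly when `X₁ + X₂` is an affine function of `X` of slope `c`. -/
theorem IsCoherentPair.integral_quadObjective_eq_iff {μ₀ μ₁ : Measure (ℝ × ℝ)}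
    (h : IsCoherentPair μ₀ μ₁) (hprob : IsProbabilityMeasure (μ₀ + μ₁)) {p : ℝ}
    (hp : μ₁.real Set.univ = p) {α β : ℝ} (hαβ : β < α) :
    ∫ z, quadObjective α β p z ∂(μ₀ + μ₁) = p * (1 - p) * (α ^ 2 / (α - β)) ↔
      (∀ᵐ z ∂μ₀, z.1 + z.2 = (2 - α / (α - β)) * p) ∧
        ∀ᵐ z ∂μ₁, z.1 + z.2 = (2 - α / (α - β)) * p + α / (α - β) := by
  have := h.finite₀
  have := h.finite₁
  have key : ∀ (ν : Measure (ℝ × ℝ)) (r : ℝ), IsFiniteMeasure ν →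
      (∀ᵐ z ∂ν, z ∈ Set.Icc (0 : ℝ) 1 ×ˢ Set.Icc (0 : ℝ) 1) →
      (∫ z, (z.1 + z.2 - r) ^ 2 ∂ν = 0 ↔ ∀ᵐ z ∂ν, z.1 + z.2 = r) := by
    intro ν r _ hν
    rw [integral_eq_zero_iff_of_nonneg (fun z => sq_nonneg _)
      (integrable_of_ae_mem_unitSquare hν (f := fun z => (z.1 + z.2 - r) ^ 2) (by fun_prop))]
    refine Filter.eventually_congr (.of_forall fun z => ?_)
    simp [sub_eq_zero]
  rw [h.integral_quadObjective hprob hp hαβ.ne', ← key μ₀ _ inferInstance h.mem₀,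
    ← key μ₁ _ inferInstance h.mem₁]
  have h0 : 0 ≤ ∫ z, (z.1 + z.2 - (2 - α / (α - β)) * p) ^ 2 ∂μ₀ :=
    integral_nonneg fun z => sq_nonneg _
  have h1 : 0 ≤ ∫ z, (z.1 + z.2 - ((2 - α / (α - β)) * p + α / (α - β))) ^ 2 ∂μ₁ :=
    integral_nonneg fun z => sq_nonneg _
  rw [sub_eq_self, mul_eq_zero, or_iff_right (sub_pos.2 hαβ).ne', add_eq_zero_iff_of_nonneg h0 h1]

theorem integral_quadObjective_le_of_mem_coherentSet {p : ℝ} {μ : Measure (ℝ × ℝ)}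
    (hμ : μ ∈ coherentSet p) {α β : ℝ} (hαβ : β < α) :
    ∫ z, quadObjective α β p z ∂μ ≤ p * (1 - p) * (α ^ 2 / (α - β)) := by
  obtain ⟨μ₀, μ₁, h, rfl, hprob, hp⟩ := exists_isCoherentPair_of_mem_coherentSet hμ
  exact h.integral_quadObjective_le hprob hp hαβ

/-! ### The uninformed and the fully informed forecasters -/

/-- The law of the forecasts when neither σ-algebra carries information. -/
theorem dirac_mem_coherentSet {p : ℝ} (hp : p ∈ Set.Icc (0 : ℝ) 1) :
    Measure.dirac (p, p) ∈ coherentSet p := by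
  have hsum : ENNReal.ofReal (1 - p) • Measure.dirac (p, p) +
      ENNReal.ofReal p • Measure.dirac (p, p) = Measure.dirac ((p, p) : ℝ × ℝ) := by
    rw [← add_smul, ← ENNReal.ofReal_add (by linarith [hp.2]) hp.1]
    simp
  have hpair : IsCoherentPair (ENNReal.ofReal (1 - p) • Measure.dirac ((p, p) : ℝ × ℝ))
      (ENNReal.ofReal p • Measure.dirac (p, p)) := by
    refine ⟨⟨by simp⟩, ⟨by simp⟩, Measure.ae_smul_measure (by simpa [ae_dirac_eq] using hp) _,
      Measure.ae_smul_measure (by simpa [ae_dirac_eq] using hp) _, ?_, ?_⟩ <;>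
    · intro g hg
      rw [lintegral_smul_measure, lintegral_smul_measure, lintegral_dirac' _ (by fun_prop),
        lintegral_dirac' _ (by fun_prop), smul_eq_mul, smul_eq_mul]
      ring
  have := hpair.add_mem_coherentSet (by rw [hsum]; infer_instance)
  rw [hsum] at this
  convert this using 1
  congr 1
  simp [measureReal_def, ENNReal.toReal_ofReal hp.1]

/-- The law of `(X, X)`, the forecasts of two fully informed forecasters. -/
noncomputable def fullyInformed (p : ℝ) : Measure (ℝ × ℝ) :=
  ENNReal.ofReal (1 - p) • Measure.dirac ((0 : ℝ), (0 : ℝ)) +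
    ENNReal.ofReal p • Measure.dirac ((1 : ℝ), (1 : ℝ))

theorem fullyInformed_mem_coherentSet {p : ℝ} (hp : p ∈ Set.Icc (0 : ℝ) 1) :
    fullyInformed p ∈ coherentSet p := by
  have hprob : IsProbabilityMeasure (fullyInformed p) := by
    constructor
    simp only [fullyInformed, Measure.add_apply, Measure.smul_apply, measure_univ, smul_eq_mul,
      mul_one]
    rw [← ENNReal.ofReal_add (by linarith [hp.2]) hp.1]
    simp
  have hpair : IsCoherentPair (ENNReal.ofReal (1 - p) • Measure.dirac ((0, 0) : ℝ × ℝ))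
      (ENNReal.ofReal p • Measure.dirac (1, 1)) := by
    refine ⟨⟨by simp⟩, ⟨by simp⟩, Measure.ae_smul_measure (by simp [ae_dirac_eq]) _,
      Measure.ae_smul_measure (by simp [ae_dirac_eq]) _, ?_, ?_⟩ <;>
    · intro g hg
      rw [lintegral_smul_measure, lintegral_smul_measure, lintegral_dirac' _ (by fun_prop),
        lintegral_dirac' _ (by fun_prop), smul_eq_mul, smul_eq_mul]
      simp
  have := hpair.add_mem_coherentSet hprob
  unfold fullyInformed
  convert this using 1
  congr 1
  simp [measureReal_def, ENNReal.toReal_ofReal hp.1]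

theorem integral_quadObjective_fullyInformed {p : ℝ} (hp : p ∈ Set.Icc (0 : ℝ) 1) (α β : ℝ) :
    ∫ z, quadObjective α β p z ∂fullyInformed p = 4 * β * (p * (1 - p)) := by
  have hq := (continuous_quadObjective α β p).stronglyMeasurable
  have hi : ∀ x : ℝ × ℝ, ∀ r : ℝ, Integrable (quadObjective α β p)
      (ENNReal.ofReal r • Measure.dirac x) := fun x r =>
    (integrable_dirac' hq (by simp)).smul_measure (by simp)
  rw [fullyInformed, integral_add_measure (hi _ _) (hi _ _), integral_smul_measure,
    integral_smul_measure, integral_dirac' _ _ hq, integral_dirac' _ _ hq,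
    ENNReal.toReal_ofReal (by linarith [hp.2]), ENNReal.toReal_ofReal hp.1]
  simp only [quadObjective, smul_eq_mul]
  ring

theorem isGreatest_objectiveValues_zero {α β p : ℝ} (hp : p ∈ Set.Icc (0 : ℝ) 1) (hα : α ≤ 0)
    (hβ : β ≤ 0) : IsGreatest (objectiveValues α β p) 0 := by
  refine ⟨⟨_, dirac_mem_coherentSet hp, ?_⟩, ?_⟩
  · dsimp only
    rw [integral_dirac' _ _ (continuous_quadObjective α β p).stronglyMeasurable]
    simp only [quadObjective]
    ring
  · rintro _ ⟨μ, -, rfl⟩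
    refine integral_nonpos fun z => ?_
    simp only [quadObjective, Pi.zero_apply]
    nlinarith [mul_nonneg (neg_nonneg.2 hα) (sq_nonneg (z.1 - z.2)),
      mul_nonneg (neg_nonneg.2 hβ) (sq_nonneg (z.1 + z.2 - 2 * p))]

/-- When `α ≤ 2β`, the objective is dominated by the one with `2β` in place of `α`, for which the
fully informed forecasters attain the bound. -/
theorem isGreatest_objectiveValues_of_le {α β p : ℝ} (hp : p ∈ Set.Icc (0 : ℝ) 1) (hβ : 0 < β)
    (hαβ : α ≤ 2 * β) : IsGreatest (objectiveValues α β p) (4 * β * (p * (1 - p))) := by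
  refine ⟨⟨_, fullyInformed_mem_coherentSet hp, integral_quadObjective_fullyInformed hp α β⟩, ?_⟩
  rintro _ ⟨μ, hμ, rfl⟩
  have hb := integral_quadObjective_le_of_mem_coherentSet hμ (show β < 2 * β by linarith)
  obtain ⟨μ₀, μ₁, h, rfl, hprob, -⟩ := exists_isCoherentPair_of_mem_coherentSet hμ
  have hi : ∀ a, Integrable (quadObjective a β p) (μ₀ + μ₁) := fun a =>
    integrable_of_ae_mem_unitSquare (ae_add_measure_iff.2 ⟨h.mem₀, h.mem₁⟩)
      (continuous_quadObjective a β p)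
  refine (integral_mono (hi α) (hi (2 * β)) fun z => ?_).trans (hb.trans_eq ?_)
  · simp only [quadObjective]
    nlinarith [mul_nonneg (sub_nonneg.2 hαβ) (sq_nonneg (z.1 - z.2))]
  · have : 2 * β - β ≠ 0 := by linarith
    field_simp
    ring

theorem isGreatest_objectiveValues_of_neg_or_lt {α β p : ℝ} (hp : p ∈ Set.Icc (0 : ℝ) 1)
    (h : α < 0 ∨ 2 * β > α) :
    IsGreatest (objectiveValues α β p) (max 0 (max (4 * β) (α + β)) * (p * (1 - p))) := by
  rcases lt_or_ge 0 β with hβ | hβ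
  · have hαβ : α ≤ 2 * β := by rcases h with h | h <;> linarith
    rw [max_eq_left (show α + β ≤ 4 * β by linarith), max_eq_right (by linarith)]
    exact isGreatest_objectiveValues_of_le hp hβ hαβ
  · have hα : α ≤ 0 := by rcases h with h | h <;> linarith
    rw [max_eq_left (max_le (by linarith) (by linarith)), zero_mul]
    exact isGreatest_objectiveValues_zero hp hα hβ

/-! ### Balanced pairs of measures on the line -/

/-- An edge leads from `s` to `s + a`, or from `t` to `t + b`. The measures `σ` and `τ` are the laws
of the tails of the edges of the two kinds, with all tails and heads in `[0, 1]`. At each point `v`,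
the mass arriving by edges of one kind and the mass leaving by edges of the other kind have the
ratio `v : 1 - v`. For the measure of a pair of forecasts concentrated on two lines of slope `-1`,
the edges of the first kind correspond to the points `(1 - s, s + a)` of the upper line, and those
of the second kind to the points `(1 - (t + b), t)` of the lower line. -/
structure IsBalanced (a b : ℝ) (σ τ : Measure ℝ) : Prop where
  finite_fst : IsFiniteMeasure σ
  finite_snd : IsFiniteMeasure τ
  mem_fst : ∀ᵐ s ∂σ, s ∈ Set.Icc (0 : ℝ) 1 ∧ s + a ∈ Set.Icc (0 : ℝ) 1
  mem_snd : ∀ᵐ t ∂τ, t ∈ Set.Icc (0 : ℝ) 1 ∧ t + b ∈ Set.Icc (0 : ℝ) 1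
  fst_to_snd : ∀ g : ℝ → ℝ≥0∞, Measurable g →
    ∫⁻ s, g (s + a) * ENNReal.ofReal (1 - (s + a)) ∂σ = ∫⁻ t, g t * ENNReal.ofReal t ∂τ
  snd_to_fst : ∀ g : ℝ → ℝ≥0∞, Measurable g →
    ∫⁻ t, g (t + b) * ENNReal.ofReal (1 - (t + b)) ∂τ = ∫⁻ s, g s * ENNReal.ofReal s ∂σ

namespace IsBalanced

variable {a b : ℝ} {σ τ σ' τ' : Measure ℝ}

theorem symm (h : IsBalanced a b σ τ) : IsBalanced b a τ σ :=
  ⟨h.finite_snd, h.finite_fst, h.mem_snd, h.mem_fst, h.snd_to_fst, h.fst_to_snd⟩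

theorem add (h : IsBalanced a b σ τ) (h' : IsBalanced a b σ' τ') :
    IsBalanced a b (σ + σ') (τ + τ') := by
  have := h.finite_fst
  have := h.finite_snd
  have := h'.finite_fst
  have := h'.finite_snd
  refine ⟨inferInstance, inferInstance, ae_add_measure_iff.2 ⟨h.mem_fst, h'.mem_fst⟩,
    ae_add_measure_iff.2 ⟨h.mem_snd, h'.mem_snd⟩, fun g hg => ?_, fun g hg => ?_⟩
  · rw [lintegral_add_measure, lintegral_add_measure, h.fst_to_snd g hg, h'.fst_to_snd g hg]
  · rw [lintegral_add_measure, lintegral_add_measure, h.snd_to_fst g hg, h'.snd_to_fst g hg]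

theorem smul (h : IsBalanced a b σ τ) (r : ℝ≥0) : IsBalanced a b (r • σ) (r • τ) := by
  have := h.finite_fst
  have := h.finite_snd
  refine ⟨inferInstance, inferInstance, Measure.ae_smul_measure h.mem_fst _,
    Measure.ae_smul_measure h.mem_snd _, fun g hg => ?_, fun g hg => ?_⟩
  · rw [lintegral_smul_measure, lintegral_smul_measure, h.fst_to_snd g hg]
  · rw [lintegral_smul_measure, lintegral_smul_measure, h.snd_to_fst g hg]

/-- The balance at a single point. -/
theorem mul_measure_singleton (h : IsBalanced a b σ τ) (s : ℝ) :
    ENNReal.ofReal (1 - (s + a)) * σ {s} = ENNReal.ofReal (s + a) * τ {s + a} := by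
  have e := h.fst_to_snd (Set.indicator {s + a} 1)
    (measurable_one.indicator (measurableSet_singleton _))
  have e1 : ∀ x, Set.indicator {s + a} (1 : ℝ → ℝ≥0∞) (x + a) * ENNReal.ofReal (1 - (x + a)) =
      Set.indicator {s} (fun _ => ENNReal.ofReal (1 - (s + a))) x := by
    intro x
    by_cases hx : x = s <;> simp [Set.indicator, hx]
  have e2 : ∀ x, Set.indicator {s + a} (1 : ℝ → ℝ≥0∞) x * ENNReal.ofReal x =
      Set.indicator {s + a} (fun _ => ENNReal.ofReal (s + a)) x := by
    intro x
    by_cases hx : x = s + a <;> simp [Set.indicator, hx]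
  simp only [e1, e2] at e
  rwa [lintegral_indicator_const (measurableSet_singleton _),
    lintegral_indicator_const (measurableSet_singleton _)] at e

/-- The mass of `τ` below `k + a` is determined by the mass of `σ` below `k`, except at the point
`0`, where the balance gives no information about the mass that leaves. -/
theorem restrict_snd_eq (h : IsBalanced a b σ τ) (h' : IsBalanced a b σ' τ') {k : ℝ}
    (hk : σ.restrict (Set.Iio k) = σ'.restrict (Set.Iio k)) (h0 : τ {0} = τ' {0}) :
    τ.restrict (Set.Iio (k + a)) = τ'.restrict (Set.Iio (k + a)) := by
  -- Dividing by `t`, the mass of `B ∩ (0, ∞)` is the integral of a function of the heads over `σ`.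
  have key : ∀ {σ τ : Measure ℝ}, IsBalanced a b σ τ → ∀ B, MeasurableSet B → B ⊆ Set.Iio (k + a) →
      τ B = τ {0} * B.indicator 1 0 + ∫⁻ s in Set.Iio k,
        (B ∩ Set.Ioi 0).indicator (fun t => (ENNReal.ofReal t)⁻¹) (s + a) *
          ENNReal.ofReal (1 - (s + a)) ∂σ := by
    intro σ τ h B hB hBk
    have hB0 : MeasurableSet (B ∩ Set.Ioi 0) := hB.inter measurableSet_Ioi
    have e := h.fst_to_snd ((B ∩ Set.Ioi 0).indicator fun t => (ENNReal.ofReal t)⁻¹)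
      (by fun_prop (disch := assumption))
    have e1 : ∫⁻ s, (B ∩ Set.Ioi 0).indicator (fun t => (ENNReal.ofReal t)⁻¹) (s + a) *
        ENNReal.ofReal (1 - (s + a)) ∂σ = ∫⁻ s in Set.Iio k,
        (B ∩ Set.Ioi 0).indicator (fun t => (ENNReal.ofReal t)⁻¹) (s + a) *
          ENNReal.ofReal (1 - (s + a)) ∂σ := by
      rw [← lintegral_indicator measurableSet_Iio]
      refine lintegral_congr fun s => ?_
      by_cases hs : s < k
      · rw [Set.indicator_of_mem (show s ∈ Set.Iio k from hs)]
      · rw [Set.indicator_of_notMem (show s ∉ Set.Iio k from hs), Set.indicator_of_notMem, zero_mul]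
        intro hm
        have := hBk hm.1
        simp only [Set.mem_Iio, add_lt_add_iff_right] at this
        exact hs this
    have e2 : ∀ t, (B ∩ Set.Ioi 0).indicator (fun t => (ENNReal.ofReal t)⁻¹) t * ENNReal.ofReal t =
        (B ∩ Set.Ioi 0).indicator 1 t := by
      intro t
      by_cases ht : t ∈ B ∩ Set.Ioi 0
      · rw [Set.indicator_of_mem ht, Set.indicator_of_mem ht, Pi.one_apply]
        exact ENNReal.inv_mul_cancel (by simpa using ht.2) (by simp)
      · rw [Set.indicator_of_notMem ht, Set.indicator_of_notMem ht, zero_mul]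
    rw [← e1, e]
    simp only [e2]
    rw [lintegral_indicator_one hB0]
    have hsplit : τ B = τ (B ∩ {0}) + τ (B ∩ Set.Ioi 0) := by
      rw [← measure_union _ hB0]
      · refine measure_congr ?_
        filter_upwards [h.mem_snd] with t ht
        have : (t ∈ B) ↔ (t ∈ B ∩ {0} ∪ B ∩ Set.Ioi 0) := by
          simp only [Set.mem_union, Set.mem_inter_iff, Set.mem_singleton_iff, Set.mem_Ioi]
          have := ht.1.1
          rcases this.eq_or_lt with h | h
          · simp [← h]
          · simp [h, h.ne']
        exact propext this
      · rw [Set.disjoint_left]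
        rintro t ⟨-, rfl⟩ ⟨-, h⟩
        exact lt_irrefl _ (Set.mem_Ioi.1 h)
    rw [hsplit]
    congr 1
    by_cases h0 : (0 : ℝ) ∈ B
    · rw [Set.inter_eq_right.2 (Set.singleton_subset_iff.2 h0)]
      simp [h0]
    · rw [Set.inter_singleton_eq_empty.2 h0]
      simp [h0]
  ext B hB
  rw [Measure.restrict_apply hB, Measure.restrict_apply hB,
    key h _ (hB.inter measurableSet_Iio) Set.inter_subset_right,
    key h' _ (hB.inter measurableSet_Iio) Set.inter_subset_right, hk, h0]

/-- A balanced pair is determined by the masses leaving the point `0`. -/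
theorem eq_of_measure_zero_eq (h : IsBalanced a b σ τ) (h' : IsBalanced a b σ' τ')
    (hab : 0 < a + b) (hσ : σ {0} = σ' {0}) (hτ : τ {0} = τ' {0}) : σ = σ' ∧ τ = τ' := by
  have step : ∀ n : ℕ, σ.restrict (Set.Iio (n * (a + b))) = σ'.restrict (Set.Iio (n * (a + b))) := by
    intro n
    induction n with
    | zero =>
      have z : ∀ {σ τ : Measure ℝ}, IsBalanced a b σ τ →
          σ.restrict (Set.Iio (((0 : ℕ) : ℝ) * (a + b))) = 0 := by
        intro σ τ h
        rw [Measure.restrict_eq_zero]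
        refine measure_mono_null (t := {s | ¬ (s ∈ Set.Icc (0 : ℝ) 1 ∧ s + a ∈ Set.Icc (0 : ℝ) 1)})
          ?_ h.mem_fst
        intro s hs hm
        have := hm.1.1
        simp at hs
        linarith
      rw [z h, z h']
    | succ n ih =>
      have := h.symm.restrict_snd_eq h'.symm (h.restrict_snd_eq h' ih hτ) hσ
      have e : ((n + 1 : ℕ) : ℝ) * (a + b) = n * (a + b) + a + b := by push_cast; ring
      rwa [e]
  have hcover : ⋃ n : ℕ, Set.Iio ((n : ℝ) * (a + b)) = Set.univ := by
    refine Set.eq_univ_of_forall fun x => Set.mem_iUnion.2 ?_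
    obtain ⟨n, hn⟩ := exists_nat_gt (x / (a + b))
    exact ⟨n, (div_lt_iff₀ hab).1 hn⟩
  have hcover' : ⋃ n : ℕ, Set.Iio ((n : ℝ) * (a + b) + a) = Set.univ := by
    refine Set.eq_univ_of_forall fun x => Set.mem_iUnion.2 ?_
    obtain ⟨n, hn⟩ := exists_nat_gt ((x - a) / (a + b))
    exact ⟨n, by have := (div_lt_iff₀ hab).1 hn; simp only [Set.mem_Iio]; linarith⟩
  constructor
  · rw [← Measure.restrict_univ (μ := σ), ← Measure.restrict_univ (μ := σ'), ← hcover]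
    exact Measure.restrict_iUnion_congr.2 step
  · rw [← Measure.restrict_univ (μ := τ), ← Measure.restrict_univ (μ := τ'), ← hcover']
    exact Measure.restrict_iUnion_congr.2 fun n => h.restrict_snd_eq h' (step n) hτ

end IsBalanced

/-! ### Walks -/

/-- The walk that starts at `0` and takes steps `a`, `b`, `a`, `b`, …. -/
def walk (a b : ℝ) (n : ℕ) : ℝ := ((n + 1) / 2 : ℕ) * a + (n / 2 : ℕ) * b

/-- The walk that starts at `0` with the step `a` stays strictly between `0` and `1` until it hits
`1` at time `n`. -/
structure IsCompleteWalk (a b : ℝ) (n : ℕ) : Prop where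
  pos : 0 < n
  eq_one : walk a b n = 1
  mem_Ioo : ∀ j, 0 < j → j < n → walk a b j ∈ Set.Ioo (0 : ℝ) 1

@[simp] theorem walk_zero (a b : ℝ) : walk a b 0 = 0 := by simp [walk]

theorem walk_two_mul (a b : ℝ) (k : ℕ) : walk a b (2 * k) = k * (a + b) := by
  have h1 : (2 * k + 1) / 2 = k := by omega
  have h2 : 2 * k / 2 = k := by omega
  rw [walk, h1, h2]
  ring

theorem walk_two_mul_add_one (a b : ℝ) (k : ℕ) :
    walk a b (2 * k + 1) = k * (a + b) + a := by
  have h1 : (2 * k + 1 + 1) / 2 = k + 1 := by omega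
  have h2 : (2 * k + 1) / 2 = k := by omega
  rw [walk, h1, h2]
  push_cast
  ring

theorem walk_succ_of_even (a b : ℝ) {j : ℕ} (hj : Even j) : walk a b (j + 1) = walk a b j + a := by
  obtain ⟨k, rfl⟩ := hj
  rw [← two_mul, walk_two_mul, walk_two_mul_add_one]

theorem walk_succ_of_odd (a b : ℝ) {j : ℕ} (hj : ¬ Even j) :
    walk a b (j + 1) = walk a b j + b := by
  obtain ⟨k, rfl⟩ := Nat.not_even_iff_odd.1 hj
  rw [show 2 * k + 1 + 1 = 2 * (k + 1) by ring, walk_two_mul, walk_two_mul_add_one]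
  push_cast
  ring

/-- Mass leaving `0` has to be passed on along the walk, until the walk hits `1`. -/
theorem IsBalanced.exists_isCompleteWalk {a b : ℝ} {σ τ : Measure ℝ} (h : IsBalanced a b σ τ)
    (hab : 0 < a + b) (h0 : σ {0} ≠ 0) : ∃ n, IsCompleteWalk a b n := by
  have head : ∀ {a b : ℝ} {σ τ : Measure ℝ}, IsBalanced a b σ τ → ∀ s, σ {s} ≠ 0 →
      s + a ∈ Set.Icc (0 : ℝ) 1 := by
    intro a b σ τ h s hs
    by_contra hn
    refine hs (measure_mono_null (t := {s | ¬ (s ∈ Set.Icc (0 : ℝ) 1 ∧ s + a ∈ Set.Icc (0 : ℝ) 1)})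
      ?_ h.mem_fst)
    rintro x hx hm
    rw [Set.mem_singleton_iff.1 hx] at hm
    exact hn hm.2
  have pass : ∀ {a b : ℝ} {σ τ : Measure ℝ}, IsBalanced a b σ τ → ∀ s, σ {s} ≠ 0 →
      s + a ≠ 1 → s + a ∈ Set.Ioo (0 : ℝ) 1 ∧ τ {s + a} ≠ 0 := by
    intro a b σ τ h s hs h1
    have hI := head h s hs
    have hlt : s + a < 1 := lt_of_le_of_ne hI.2 h1
    have e := h.mul_measure_singleton s
    have hne : ENNReal.ofReal (1 - (s + a)) * σ {s} ≠ 0 :=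
      mul_ne_zero (by simpa using hlt) hs
    rw [e] at hne
    refine ⟨⟨?_, hlt⟩, right_ne_zero_of_mul hne⟩
    simpa using left_ne_zero_of_mul hne
  set m : ℕ → ℝ≥0∞ := fun j => if Even j then σ {walk a b j} else τ {walk a b j} with hm
  have next : ∀ j, m j ≠ 0 → walk a b (j + 1) ≠ 1 →
      walk a b (j + 1) ∈ Set.Ioo (0 : ℝ) 1 ∧ m (j + 1) ≠ 0 := by
    intro j hj h1
    by_cases he : Even j
    · have ho : ¬ Even (j + 1) := by simpa [Nat.even_add_one] using he
      simp only [hm, if_pos he, if_neg ho] at hj ⊢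
      rw [walk_succ_of_even a b he] at h1 ⊢
      exact pass h _ hj h1
    · have ho : Even (j + 1) := by simpa [Nat.even_add_one] using he
      simp only [hm, if_neg he, if_pos ho] at hj ⊢
      rw [walk_succ_of_odd a b he] at h1 ⊢
      exact pass h.symm _ hj h1
  have hpos : ∀ j, (∀ i, 0 < i → i ≤ j → walk a b i ≠ 1) →
      m j ≠ 0 ∧ (0 < j → walk a b j ∈ Set.Ioo (0 : ℝ) 1) := by
    intro j
    induction j with
    | zero => exact fun _ => ⟨by simpa [hm] using h0, fun h => absurd h (lt_irrefl _)⟩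
    | succ j ih =>
      intro hj
      have := next j (ih fun i hi hij => hj i hi (by omega)).1 (hj _ j.succ_pos le_rfl)
      exact ⟨this.2, fun _ => this.1⟩
  have hits : ∃ n, 0 < n ∧ walk a b n = 1 := by
    by_contra! hn
    obtain ⟨k, hk⟩ := exists_nat_gt (1 / (a + b))
    have := ((hpos (2 * (k + 1)) fun i hi _ => hn i hi).2 (by omega)).2
    rw [walk_two_mul] at this
    rw [div_lt_iff₀ hab] at hk
    push_cast at this
    nlinarith
  classical
  obtain ⟨hn0, hn1⟩ := Nat.find_spec hits
  exact ⟨Nat.find hits, hn0, hn1, fun j hj0 hj =>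
    (hpos j fun i hi hij h => Nat.find_min hits (by omega) ⟨hi, h⟩).2 hj0⟩

/-! ### The balanced pair of a complete walk -/

/-- The weights of the steps of a walk, as prescribed by the balance at the points passed. -/
noncomputable def walkWeight (a b : ℝ) (j : ℕ) : ℝ :=
  ∏ i ∈ Finset.range j, (1 - walk a b (i + 1)) / walk a b (i + 1)

/-- The law of the tails of those of the first `n` steps whose number satisfies `r`. -/
noncomputable def walkMeasure (a b : ℝ) (n : ℕ) (r : ℕ → Prop) [DecidablePred r] : Measure ℝ :=
  ∑ j ∈ Finset.range n with r j, ENNReal.ofReal (walkWeight a b j) • Measure.dirac (walk a b j)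

namespace IsCompleteWalk

variable {a b : ℝ} {n : ℕ}

theorem walk_mem_Ioc (h : IsCompleteWalk a b n) {j : ℕ} (hj0 : 0 < j) (hj : j ≤ n) :
    walk a b j ∈ Set.Ioc (0 : ℝ) 1 := by
  rcases hj.eq_or_lt with rfl | hlt
  · rw [h.eq_one]
    simp
  · exact Set.Ioo_subset_Ioc_self (h.mem_Ioo j hj0 hlt)

theorem walk_mem_Ico (h : IsCompleteWalk a b n) {j : ℕ} (hj : j < n) :
    walk a b j ∈ Set.Ico (0 : ℝ) 1 := by
  rcases j.eq_zero_or_pos with rfl | h0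
  · simp
  · exact Set.Ioo_subset_Ico_self (h.mem_Ioo j h0 hj)

theorem walkWeight_pos (h : IsCompleteWalk a b n) {j : ℕ} (hj : j < n) : 0 < walkWeight a b j := by
  refine Finset.prod_pos fun i hi => ?_
  rw [Finset.mem_range] at hi
  have := h.mem_Ioo (i + 1) i.succ_pos (by omega)
  exact div_pos (sub_pos.2 this.2) this.1

theorem walkWeight_succ_mul (h : IsCompleteWalk a b n) {j : ℕ} (hj : j < n) :
    walkWeight a b (j + 1) * walk a b (j + 1) = walkWeight a b j * (1 - walk a b (j + 1)) := by
  have := (h.walk_mem_Ioc j.succ_pos hj).1.ne'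
  rw [walkWeight, Finset.prod_range_succ, ← walkWeight]
  field_simp

/-- Steps whose number satisfies `r` end where the steps whose number satisfies `r'` begin. The
boundary terms vanish: the walk starts at `0`, and it hits `1` at time `n`. -/
theorem lintegral_walkMeasure (h : IsCompleteWalk a b n) {r r' : ℕ → Prop} [DecidablePred r]
    [DecidablePred r'] (hr : ∀ j, r' (j + 1) ↔ r j) {s : ℝ}
    (hs : ∀ j, r j → walk a b (j + 1) = walk a b j + s) {g : ℝ → ℝ≥0∞} (hg : Measurable g) :
    ∫⁻ x, g (x + s) * ENNReal.ofReal (1 - (x + s)) ∂walkMeasure a b n r =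
      ∫⁻ x, g x * ENNReal.ofReal x ∂walkMeasure a b n r' := by
  set F : ℕ → ℝ≥0∞ := fun j => if r' j then ENNReal.ofReal (walkWeight a b j) *
    (g (walk a b j) * ENNReal.ofReal (walk a b j)) else 0 with hF
  have e1 : ∫⁻ x, g (x + s) * ENNReal.ofReal (1 - (x + s)) ∂walkMeasure a b n r =
      ∑ j ∈ Finset.range n, F (j + 1) := by
    rw [walkMeasure, lintegral_finsetSum_measure, Finset.sum_filter]
    refine Finset.sum_congr rfl fun j hj => ?_
    rw [Finset.mem_range] at hj
    simp only [hF, hr]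
    split_ifs with hrj
    · have hw := h.walkWeight_pos hj
      have hv := h.walk_mem_Ioc j.succ_pos hj
      rw [lintegral_smul_measure, lintegral_dirac' _ (by fun_prop), ← hs j hrj, smul_eq_mul,
        mul_left_comm, ← ENNReal.ofReal_mul hw.le, ← h.walkWeight_succ_mul hj, mul_left_comm,
        ENNReal.ofReal_mul' hv.1.le]
    · rfl
  have e2 : ∫⁻ x, g x * ENNReal.ofReal x ∂walkMeasure a b n r' = ∑ j ∈ Finset.range n, F j := by
    rw [walkMeasure, lintegral_finsetSum_measure, Finset.sum_filter]
    refine Finset.sum_congr rfl fun j hj => ?_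
    simp only [hF]
    split_ifs with hrj
    · rw [lintegral_smul_measure, lintegral_dirac' _ (by fun_prop), smul_eq_mul]
    · rfl
  have hF0 : F 0 = 0 := by simp [hF]
  have hFn : F n = 0 := by
    obtain ⟨k, rfl⟩ : ∃ k, n = k + 1 := ⟨n - 1, by have := h.pos; omega⟩
    have := h.walkWeight_succ_mul k.lt_succ_self
    rw [h.eq_one, sub_self, mul_zero, mul_one] at this
    simp [hF, this]
  rw [e1, e2]
  have := Finset.sum_range_succ' F n
  rw [Finset.sum_range_succ, hF0, hFn, add_zero, add_zero] at this
  exact this.symm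

theorem ae_walkMeasure (h : IsCompleteWalk a b n) {r : ℕ → Prop} [DecidablePred r] {s : ℝ}
    (hs : ∀ j, r j → walk a b (j + 1) = walk a b j + s) :
    ∀ᵐ x ∂walkMeasure a b n r, x ∈ Set.Icc (0 : ℝ) 1 ∧ x + s ∈ Set.Icc (0 : ℝ) 1 := by
  rw [walkMeasure, ae_finsetSum_measure_iff]
  intro j hj
  rw [Finset.mem_filter, Finset.mem_range] at hj
  refine Measure.ae_smul_measure ?_ _
  rw [ae_dirac_eq, Filter.eventually_pure, ← hs j hj.2]
  exact ⟨Set.Ico_subset_Icc_self (h.walk_mem_Ico hj.1),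
    Set.Ioc_subset_Icc_self (h.walk_mem_Ioc j.succ_pos hj.1)⟩

theorem isBalanced (h : IsCompleteWalk a b n) :
    IsBalanced a b (walkMeasure a b n Even) (walkMeasure a b n fun j => ¬ Even j) := by
  have fin : ∀ (r : ℕ → Prop) [DecidablePred r], IsFiniteMeasure (walkMeasure a b n r) := by
    intro r _
    constructor
    simp only [walkMeasure, Measure.coe_finsetSum, Finset.sum_apply, Measure.smul_apply,
      measure_univ, smul_eq_mul, mul_one]
    exact ENNReal.sum_lt_top.2 fun j _ => ENNReal.ofReal_lt_top
  refine ⟨fin _, fin _, h.ae_walkMeasure fun j hj => walk_succ_of_even a b hj,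
    h.ae_walkMeasure fun j hj => walk_succ_of_odd a b hj, fun g hg => ?_, fun g hg => ?_⟩
  · exact h.lintegral_walkMeasure (fun j => by simp [Nat.even_add_one])
      (fun j hj => walk_succ_of_even a b hj) hg
  · exact h.lintegral_walkMeasure (fun j => by simp [Nat.even_add_one])
      (fun j hj => walk_succ_of_odd a b hj) hg

theorem walkMeasure_even_zero_ne_zero (h : IsCompleteWalk a b n) :
    walkMeasure a b n Even {0} ≠ 0 := by
  simp only [walkMeasure, Measure.coe_finsetSum, Finset.sum_apply, Measure.smul_apply, smul_eq_mul]
  rw [Ne, Finset.sum_eq_zero_iff]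
  intro hz
  have := hz 0 (by simpa using h.pos)
  simp [walkWeight] at this

theorem walkMeasure_odd_zero (h : IsCompleteWalk a b n) :
    walkMeasure a b n (fun j => ¬ Even j) {0} = 0 := by
  simp only [walkMeasure, Measure.coe_finsetSum, Finset.sum_apply, Measure.smul_apply, smul_eq_mul]
  refine Finset.sum_eq_zero fun j hj => ?_
  rw [Finset.mem_filter, Finset.mem_range] at hj
  have h0 : 0 < j := by
    rcases j.eq_zero_or_pos with rfl | h0
    · simp at hj
    · exact h0
  have := (h.walk_mem_Ioc h0 hj.1.le).1.ne'
  rw [Measure.dirac_apply' _ (measurableSet_singleton _)]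
  simp [this]

end IsCompleteWalk

/-! ### Ladder distributions from walks -/

theorem support_sum_smul_dirac {ι : Type*} [Fintype ι] (w : ι → ℝ≥0∞) (hw : ∀ i, w i ≠ 0)
    (z : ι → ℝ × ℝ) : (∑ i, w i • Measure.dirac (z i)).support = Set.range z := by
  have happ : ∀ U : Set (ℝ × ℝ), (∑ i, w i • Measure.dirac (z i)) U =
      ∑ i, w i * Measure.dirac (z i) U := by
    intro U
    simp [Measure.coe_finsetSum, Finset.sum_apply, smul_eq_mul]
  ext x
  constructor
  · intro hx
    by_contra hn
    have hU : (Set.range z)ᶜ ∈ nhds x :=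
      (Set.finite_range z).isClosed.isOpen_compl.mem_nhds hn
    refine ((Measure.mem_support_iff_forall x).1 hx _ hU).ne' ?_
    rw [happ]
    refine Finset.sum_eq_zero fun i _ => ?_
    rw [Measure.dirac_apply' _ (Set.finite_range z).measurableSet.compl]
    simp
  · rintro ⟨i, rfl⟩
    refine (Measure.mem_support_iff_forall _).2 fun U hU => ?_
    rw [happ]
    refine pos_iff_ne_zero.2 fun hz => ?_
    have := (Finset.sum_eq_zero_iff.1 hz) i (Finset.mem_univ i)
    rw [Measure.dirac_apply_of_mem (mem_of_mem_nhds hU), mul_one] at this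
    exact hw i this

theorem ncard_fiber_le_two {n : ℕ} {q : ℕ → ℕ}
    (hq : (∀ j, q j = (j + 1) / 2) ∨ ∀ j, q j = j / 2) {f : Fin n → ℝ} {x c : ℝ} (hc : c ≠ 0)
    (hf : ∀ i, f i = x + c * q i) (y : ℝ) : {i | f i = y}.ncard ≤ 2 := by
  rcases Set.eq_empty_or_nonempty {i | f i = y} with he | ⟨i₀, h₀⟩
  · simp [he]
  have hsub : ∀ i, f i = y → q i = q i₀ := by
    intro i hi
    have e : x + c * q i = x + c * q i₀ := by rw [← hf, ← hf, hi, h₀]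
    exact_mod_cast mul_left_cancel₀ hc (add_left_cancel e)
  rw [← Set.ncard_image_of_injective _ (Fin.val_injective)]
  rcases hq with hq | hq
  · refine (Set.ncard_le_ncard (t := {2 * q i₀ - 1, 2 * q i₀}) ?_).trans ((Set.ncard_insert_le _ _).trans (by simp))
    rintro _ ⟨i, hi, rfl⟩
    have := hsub i hi
    rw [hq] at this
    simp only [Set.mem_insert_iff, Set.mem_singleton_iff]
    omega
  · refine (Set.ncard_le_ncard (t := {2 * q i₀, 2 * q i₀ + 1}) ?_).trans ((Set.ncard_insert_le _ _).trans (by simp))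
    rintro _ ⟨i, hi, rfl⟩
    have := hsub i hi
    rw [hq] at this
    simp only [Set.mem_insert_iff, Set.mem_singleton_iff]
    omega

/-- Positive masses on a staircase that takes steps `-c` and `c` in the two coordinates, in turns,
form a ladder distribution. -/
theorem isLadderDistribution_of_staircase {n : ℕ} {w : Fin n → ℝ≥0∞} (hw : ∀ i, w i ≠ 0)
    {z : Fin n → ℝ × ℝ} {x y c : ℝ} (hc : 0 < c) {u d : ℕ → ℕ}
    (hud : (∀ j, u j = (j + 1) / 2 ∧ d j = j / 2) ∨ ∀ j, u j = j / 2 ∧ d j = (j + 1) / 2)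
    (hz : ∀ i, z i = (x + -c * u i, y + c * d i))
    (hprob : IsProbabilityMeasure (∑ i, w i • Measure.dirac (z i))) :
    IsLadderDistribution n (∑ i, w i • Measure.dirac (z i)) := by
  have hu : Monotone u := fun i j hij => by
    rcases hud with h | h <;> rw [(h i).1, (h j).1] <;> omega
  have hd : Monotone d := fun i j hij => by
    rcases hud with h | h <;> rw [(h i).2, (h j).2] <;> omega
  refine ⟨hprob, z, support_sum_smul_dirac w hw z, ?_, Or.inr ?_, Or.inl ?_, ?_, ?_, ?_⟩
  · intro i j hij
    rw [hz, hz, Prod.mk.injEq] at hij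
    have h1 : u i = u j := by
      exact_mod_cast mul_left_cancel₀ (neg_ne_zero.2 hc.ne') (add_left_cancel hij.1)
    have h2 : d i = d j := by exact_mod_cast mul_left_cancel₀ hc.ne' (add_left_cancel hij.2)
    ext
    rcases hud with h | h <;> rw [(h i).1, (h j).1] at h1 <;> rw [(h i).2, (h j).2] at h2 <;> omega
  · intro i j hij
    have : (u i : ℝ) ≤ u j := by exact_mod_cast hu hij
    simp only [hz]
    nlinarith
  · intro i j hij
    have : (d i : ℝ) ≤ d j := by exact_mod_cast hd hij
    simp only [hz]
    nlinarith
  · intro i j hij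
    have : u i = u j ∨ d i = d j := by
      rw [← hij]
      rcases hud with h | h <;> rw [(h _).1, (h _).2, (h _).1, (h _).2] <;> omega
    rcases this with h | h
    · exact Or.inl (by rw [hz, hz, h])
    · exact Or.inr (by rw [hz, hz, h])
  · exact ncard_fiber_le_two (q := u) (hud.imp (fun h j => (h j).1) fun h j => (h j).1)
      (neg_ne_zero.2 hc.ne') fun i => by rw [hz]
  · exact ncard_fiber_le_two (q := d) (hud.symm.imp (fun h j => (h j).2) fun h j => (h j).2)
      hc.ne' fun i => by rw [hz]

/-- The measure on the plane that corresponds to the laws `σ`, `τ` of the tails of edges: an edge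
from `s` to `s + a` is the point `(1 - s, s + a)`, and an edge from `t` to `t + b` is the point
`(1 - (t + b), t)`. -/
noncomputable def edgeLaw (a b : ℝ) (σ τ : Measure ℝ) : Measure (ℝ × ℝ) :=
  σ.map (fun s => (1 - s, s + a)) + τ.map (fun t => (1 - (t + b), t))

theorem edgeLaw_smul (a b : ℝ) (σ τ : Measure ℝ) (r : ℝ≥0) :
    edgeLaw a b (r • σ) (r • τ) = r • edgeLaw a b σ τ := by
  simp [edgeLaw, Measure.map_smul]

theorem edgeLaw_add (a b : ℝ) (σ τ σ' τ' : Measure ℝ) :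
    edgeLaw a b (σ + σ') (τ + τ') = edgeLaw a b σ τ + edgeLaw a b σ' τ' := by
  simp only [edgeLaw]
  rw [Measure.map_add _ _ (by fun_prop), Measure.map_add _ _ (by fun_prop)]
  abel

theorem edgeLaw_univ (a b : ℝ) (σ τ : Measure ℝ) :
    edgeLaw a b σ τ Set.univ = σ Set.univ + τ Set.univ := by
  rw [edgeLaw, Measure.add_apply, Measure.map_apply (by fun_prop) MeasurableSet.univ,
    Measure.map_apply (by fun_prop) MeasurableSet.univ, Set.preimage_univ, Set.preimage_univ]

theorem map_walkMeasure (a b : ℝ) (n : ℕ) (r : ℕ → Prop) [DecidablePred r] {f : ℝ → ℝ × ℝ}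
    (hf : Measurable f) : (walkMeasure a b n r).map f = ∑ j ∈ Finset.range n,
      if r j then ENNReal.ofReal (walkWeight a b j) • Measure.dirac (f (walk a b j)) else 0 := by
  rw [walkMeasure, ← Measure.mapₗ_apply_of_measurable hf, map_sum, Finset.sum_filter]
  refine Finset.sum_congr rfl fun j _ => ?_
  split_ifs
  · rw [map_smul, Measure.mapₗ_apply_of_measurable hf, Measure.map_dirac' hf]
  · rfl

theorem edgeLaw_walkMeasure (a b : ℝ) (n : ℕ) :
    edgeLaw a b (walkMeasure a b n Even) (walkMeasure a b n fun j => ¬ Even j) =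
      ∑ i : Fin n, ENNReal.ofReal (walkWeight a b i) • Measure.dirac
        ((1 + -(a + b) * ((i + 1) / 2 : ℕ), a + (a + b) * (i / 2 : ℕ)) : ℝ × ℝ) := by
  rw [edgeLaw, map_walkMeasure _ _ _ _ (by fun_prop), map_walkMeasure _ _ _ _ (by fun_prop),
    ← Finset.sum_add_distrib, Finset.sum_range]
  refine Finset.sum_congr rfl fun i _ => ?_
  by_cases hi : Even (i : ℕ)
  · obtain ⟨k, hk⟩ := hi.two_dvd
    rw [if_pos hi, if_neg (not_not.2 hi), add_zero, hk, walk_two_mul,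
      show (2 * k + 1) / 2 = k by omega, show 2 * k / 2 = k by omega]
    congr 3 <;> ring
  · obtain ⟨k, hk⟩ := Nat.not_even_iff_odd.1 hi
    rw [if_neg hi, if_pos hi, zero_add, hk, walk_two_mul_add_one,
      show (2 * k + 1 + 1) / 2 = k + 1 by omega, show (2 * k + 1) / 2 = k by omega]
    push_cast
    congr 3 <;> ring

theorem edgeLaw_walkMeasure_swap (a b : ℝ) (n : ℕ) :
    edgeLaw b a (walkMeasure a b n fun j => ¬ Even j) (walkMeasure a b n Even) =
      ∑ i : Fin n, ENNReal.ofReal (walkWeight a b i) • Measure.dirac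
        ((1 - a + -(a + b) * (i / 2 : ℕ), 0 + (a + b) * ((i + 1) / 2 : ℕ)) : ℝ × ℝ) := by
  rw [edgeLaw, map_walkMeasure _ _ _ _ (by fun_prop), map_walkMeasure _ _ _ _ (by fun_prop),
    ← Finset.sum_add_distrib, Finset.sum_range]
  refine Finset.sum_congr rfl fun i _ => ?_
  by_cases hi : Even (i : ℕ)
  · obtain ⟨k, hk⟩ := hi.two_dvd
    rw [if_pos hi, if_neg (not_not.2 hi), zero_add, hk, walk_two_mul,
      show (2 * k + 1) / 2 = k by omega, show 2 * k / 2 = k by omega]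
    congr 3 <;> ring
  · obtain ⟨k, hk⟩ := Nat.not_even_iff_odd.1 hi
    rw [if_neg hi, if_pos hi, add_zero, hk, walk_two_mul_add_one,
      show (2 * k + 1 + 1) / 2 = k + 1 by omega, show (2 * k + 1) / 2 = k by omega]
    push_cast
    congr 3 <;> ring

/-- A complete walk of `n` steps carries a balanced pair of total mass one. The corresponding
distribution on the plane is a ladder distribution with `n` points, whichever of the two lines the
first step belongs to. -/
theorem IsCompleteWalk.exists_isBalanced {a b : ℝ} {n : ℕ} (h : IsCompleteWalk a b n)
    (hab : 0 < a + b) : ∃ σ τ, IsBalanced a b σ τ ∧ σ {0} ≠ 0 ∧ τ {0} = 0 ∧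
      IsLadderDistribution n (edgeLaw a b σ τ) ∧ IsLadderDistribution n (edgeLaw b a τ σ) := by
  have hbal := h.isBalanced
  have h0 := h.walkMeasure_even_zero_ne_zero
  have h0' := h.walkMeasure_odd_zero
  have e1 := edgeLaw_walkMeasure a b n
  have e2 := edgeLaw_walkMeasure_swap a b n
  set σ := walkMeasure a b n Even
  set τ := walkMeasure a b n fun j => ¬ Even j
  have := hbal.finite_fst
  have := hbal.finite_snd
  set m : ℝ≥0∞ := σ Set.univ + τ Set.univ with hm
  have hmt : m ≠ ⊤ := ENNReal.add_ne_top.2 ⟨measure_ne_top _ _, measure_ne_top _ _⟩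
  have hm0 : m ≠ 0 := by
    intro hz
    exact h0 (measure_mono_null (Set.subset_univ _) (add_eq_zero.1 hz).1)
  set r : ℝ≥0 := m.toNNReal⁻¹
  have hr0 : r ≠ 0 := inv_ne_zero (ENNReal.toNNReal_ne_zero.2 ⟨hm0, hmt⟩)
  have hrm : (r : ℝ≥0∞) * m = 1 := by
    rw [← ENNReal.coe_toNNReal hmt, ← ENNReal.coe_mul,
      inv_mul_cancel₀ (ENNReal.toNNReal_ne_zero.2 ⟨hm0, hmt⟩), ENNReal.coe_one]
  have hw : ∀ i : Fin n, (r : ℝ≥0∞) * ENNReal.ofReal (walkWeight a b i) ≠ 0 := fun i =>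
    mul_ne_zero (by simpa using hr0) (by simpa using h.walkWeight_pos i.2)
  have hp1 : IsProbabilityMeasure (edgeLaw a b (r • σ) (r • τ)) := by
    constructor
    rw [edgeLaw_smul, Measure.smul_apply, edgeLaw_univ, ENNReal.smul_def, smul_eq_mul, hrm]
  have hp2 : IsProbabilityMeasure (edgeLaw b a (r • τ) (r • σ)) := by
    constructor
    rw [edgeLaw_smul, Measure.smul_apply, edgeLaw_univ, ENNReal.smul_def, smul_eq_mul, add_comm,
      hrm]
  have hsum : ∀ z : Fin n → ℝ × ℝ,
      r • ∑ i : Fin n, ENNReal.ofReal (walkWeight a b i) • Measure.dirac (z i) =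
        ∑ i : Fin n, ((r : ℝ≥0∞) * ENNReal.ofReal (walkWeight a b i)) • Measure.dirac (z i) := by
    intro z
    rw [Finset.smul_sum]
    refine Finset.sum_congr rfl fun i _ => ?_
    rw [← smul_smul]
    rfl
  refine ⟨r • σ, r • τ, hbal.smul r, ?_, ?_, ?_, ?_⟩
  · rw [Measure.smul_apply, ENNReal.smul_def, smul_eq_mul]
    exact mul_ne_zero (by simpa using hr0) h0
  · rw [Measure.smul_apply, h0', smul_zero]
  · rw [edgeLaw_smul, e1, hsum] at hp1 ⊢
    exact isLadderDistribution_of_staircase hw hab (u := fun j => (j + 1) / 2)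
      (d := fun j => j / 2) (Or.inl fun j => ⟨rfl, rfl⟩) (fun i => rfl) hp1
  · rw [edgeLaw_smul, e2, hsum] at hp2 ⊢
    exact isLadderDistribution_of_staircase hw hab (u := fun j => j / 2)
      (d := fun j => (j + 1) / 2) (Or.inr fun j => ⟨rfl, rfl⟩) (fun i => rfl) hp2

/-! ### Coherent distributions on two lines -/

theorem IsBalanced.isCoherentPair {a b : ℝ} {σ τ : Measure ℝ} (h : IsBalanced a b σ τ) :
    IsCoherentPair (τ.map fun t => (1 - (t + b), t)) (σ.map fun s => (1 - s, s + a)) := by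
  have := h.finite_fst
  have := h.finite_snd
  have hsq : MeasurableSet (Set.Icc (0 : ℝ) 1 ×ˢ Set.Icc (0 : ℝ) 1) :=
    measurableSet_Icc.prod measurableSet_Icc
  refine ⟨inferInstance, inferInstance, (mem_ae_map_iff (by fun_prop) hsq).2 ?_,
    (mem_ae_map_iff (by fun_prop) hsq).2 ?_, fun g hg => ?_, fun g hg => ?_⟩
  · filter_upwards [h.mem_snd] with t ht
    exact ⟨⟨by linarith [ht.2.2], by linarith [ht.2.1]⟩, ht.1⟩
  · filter_upwards [h.mem_fst] with s hs
    exact ⟨⟨by linarith [hs.1.2], by linarith [hs.1.1]⟩, hs.2⟩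
  · rw [lintegral_map (by fun_prop) (by fun_prop), lintegral_map (by fun_prop) (by fun_prop),
      h.snd_to_fst (fun s => g (1 - s)) (by fun_prop)]
    simp
  · rw [lintegral_map (by fun_prop) (by fun_prop), lintegral_map (by fun_prop) (by fun_prop),
      h.fst_to_snd g hg]

/-- A coherent distribution for which `X₁ + X₂` takes one value on `{X = 1}` and one on `{X = 0}`
comes from a balanced pair. -/
theorem IsCoherentPair.exists_isBalanced {a b : ℝ} {μ₀ μ₁ : Measure (ℝ × ℝ)}
    (h : IsCoherentPair μ₀ μ₁) (h₀ : ∀ᵐ z ∂μ₀, z.1 + z.2 = 1 - b)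
    (h₁ : ∀ᵐ z ∂μ₁, z.1 + z.2 = 1 + a) :
    ∃ σ τ, IsBalanced a b σ τ ∧ μ₀ + μ₁ = edgeLaw a b σ τ := by
  have := h.finite₀
  have := h.finite₁
  have hms : Measurable fun z : ℝ × ℝ => 1 - z.1 := by fun_prop
  have hIcc : ∀ c : ℝ, MeasurableSet {x : ℝ | x ∈ Set.Icc (0 : ℝ) 1 ∧ x + c ∈ Set.Icc (0 : ℝ) 1} :=
    fun c => measurableSet_Icc.inter ((measurable_add_const c) measurableSet_Icc)
  refine ⟨μ₁.map fun z => 1 - z.1, μ₀.map Prod.snd, ⟨inferInstance, inferInstance, ?_, ?_,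
    fun g hg => ?_, fun g hg => ?_⟩, ?_⟩
  · rw [ae_map_iff hms.aemeasurable (hIcc a)]
    filter_upwards [h.mem₁, h₁] with z hz hz1
    refine ⟨⟨by linarith [hz.1.2], by linarith [hz.1.1]⟩, ?_⟩
    rw [show 1 - z.1 + a = z.2 by linarith]
    exact hz.2
  · rw [ae_map_iff measurable_snd.aemeasurable (hIcc b)]
    filter_upwards [h.mem₀, h₀] with z hz hz0
    refine ⟨hz.2, ?_⟩
    rw [show z.2 + b = 1 - z.1 by linarith]
    exact ⟨by linarith [hz.1.2], by linarith [hz.1.1]⟩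
  · rw [lintegral_map (by fun_prop) hms, lintegral_map (by fun_prop) measurable_snd,
      ← h.snd g hg]
    refine lintegral_congr_ae ?_
    filter_upwards [h₁] with z hz
    rw [show 1 - z.1 + a = z.2 by linarith]
  · rw [lintegral_map (by fun_prop) measurable_snd, lintegral_map (by fun_prop) hms]
    have e := h.fst (fun x => g (1 - x)) (by fun_prop)
    rw [e]
    refine lintegral_congr_ae ?_
    filter_upwards [h₀] with z hz
    rw [show z.2 + b = 1 - z.1 by linarith, sub_sub_cancel]
  · rw [edgeLaw, Measure.map_map (by fun_prop) hms, Measure.map_map (by fun_prop) measurable_snd,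
      add_comm]
    congr 1
    · conv_lhs => rw [← Measure.map_id (μ := μ₁)]
      refine Measure.map_congr ?_
      filter_upwards [h₁] with z hz
      ext
      · simp
      · simp only [id, Function.comp]
        linarith
    · conv_lhs => rw [← Measure.map_id (μ := μ₀)]
      refine Measure.map_congr ?_
      filter_upwards [h₀] with z hz
      ext
      · simp only [id, Function.comp]
        linarith
      · simp

/-- The probability measures on the plane that come from a balanced pair. -/
def balancedLaws (a b : ℝ) : Set (Measure (ℝ × ℝ)) :=
  {μ | IsProbabilityMeasure μ ∧ ∃ σ τ, IsBalanced a b σ τ ∧ μ = edgeLaw a b σ τ}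

/-- The point `(1, a)` of the plane is the edge that leaves `0` by a step `a`. -/
theorem edgeLaw_singleton {a b : ℝ} (hab : 0 < a + b) (σ τ : Measure ℝ) :
    edgeLaw a b σ τ {(1, a)} = σ {0} := by
  rw [edgeLaw, Measure.add_apply, Measure.map_apply (by fun_prop) (measurableSet_singleton _),
    Measure.map_apply (by fun_prop) (measurableSet_singleton _)]
  have e1 : (fun s : ℝ => (1 - s, s + a)) ⁻¹' {(1, a)} = {0} := by
    ext s
    simp
  have e2 : (fun t : ℝ => (1 - (t + b), t)) ⁻¹' {(1, a)} = ∅ := by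
    ext t
    simp only [Set.mem_preimage, Set.mem_singleton_iff, Prod.mk.injEq, Set.mem_empty_iff_false,
      iff_false, not_and]
    intro h1 h2
    linarith
  rw [e1, e2, measure_empty, add_zero]

/-- A mass is a multiple of a nonzero mass. -/
theorem exists_nnreal_mul_eq {x y : ℝ≥0∞} (hx : x ≠ ⊤) (hy : y ≠ ⊤) (hy0 : y ≠ 0) :
    ∃ r : ℝ≥0, x = r * y := by
  refine ⟨(x / y).toNNReal, ?_⟩
  rw [ENNReal.coe_toNNReal (ENNReal.div_ne_top hx hy0), ENNReal.div_mul_cancel hy0 hy]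

theorem balancedLaws_eq_singleton {a b : ℝ} (hab : 0 < a + b) {σ₁ τ₁ : Measure ℝ}
    (h₁ : IsBalanced a b σ₁ τ₁) (hprob : IsProbabilityMeasure (edgeLaw a b σ₁ τ₁))
    (hmul : ∀ σ τ, IsBalanced a b σ τ → ∃ r : ℝ≥0, σ {0} = r * σ₁ {0} ∧ τ {0} = r * τ₁ {0}) :
    balancedLaws a b = {edgeLaw a b σ₁ τ₁} := by
  ext μ
  rw [Set.mem_singleton_iff]
  refine ⟨?_, fun h => h ▸ ⟨hprob, _, _, h₁, rfl⟩⟩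
  rintro ⟨hμ, σ, τ, h, rfl⟩
  obtain ⟨r, hσ, hτ⟩ := hmul σ τ h
  obtain ⟨rfl, rfl⟩ := h.eq_of_measure_zero_eq (h₁.smul r) hab
    (by rw [Measure.smul_apply, hσ]; rfl) (by rw [Measure.smul_apply, hτ]; rfl)
  have hr : (r : ℝ≥0∞) = 1 := by
    have := hμ.measure_univ
    rwa [edgeLaw_smul, Measure.smul_apply, hprob.measure_univ, ENNReal.smul_def, smul_eq_mul,
      mul_one] at this
  rw [edgeLaw_smul, ENNReal.coe_eq_one.1 hr, one_smul]

/-- If only the walk with first step `a` is complete, there is one balanced law. -/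
theorem exists_balancedLaws_eq_singleton {a b : ℝ} (hab : 0 < a + b) {n : ℕ}
    (h : IsCompleteWalk a b n) (hn : ∀ m, ¬ IsCompleteWalk b a m) :
    ∃ ν, IsLadderDistribution n ν ∧ balancedLaws a b = {ν} := by
  obtain ⟨σ₁, τ₁, h₁, hσ₁, hτ₁, hlad, -⟩ := h.exists_isBalanced hab
  refine ⟨_, hlad, balancedLaws_eq_singleton hab h₁ hlad.1 fun σ τ hb => ?_⟩
  have := h₁.finite_fst
  have := hb.finite_fst
  have hτ : τ {0} = 0 := by
    by_contra hne
    obtain ⟨m, hm⟩ := hb.symm.exists_isCompleteWalk (by linarith) hne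
    exact hn m hm
  obtain ⟨r, hr⟩ := exists_nnreal_mul_eq (measure_ne_top σ {0}) (measure_ne_top σ₁ {0}) hσ₁
  exact ⟨r, hr, by rw [hτ, hτ₁, mul_zero]⟩

/-- If only the walk with first step `b` is complete, there is one balanced law. -/
theorem exists_balancedLaws_eq_singleton' {a b : ℝ} (hab : 0 < a + b) {n : ℕ}
    (h : IsCompleteWalk b a n) (hn : ∀ m, ¬ IsCompleteWalk a b m) :
    ∃ ν, IsLadderDistribution n ν ∧ balancedLaws a b = {ν} := by
  obtain ⟨τ₁, σ₁, h₁, hτ₁, hσ₁, -, hlad⟩ := h.exists_isBalanced (by linarith)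
  refine ⟨_, hlad, balancedLaws_eq_singleton hab h₁.symm hlad.1 fun σ τ hb => ?_⟩
  have := h₁.finite_fst
  have := hb.finite_snd
  have hσ : σ {0} = 0 := by
    by_contra hne
    obtain ⟨m, hm⟩ := hb.exists_isCompleteWalk hab hne
    exact hn m hm
  obtain ⟨r, hr⟩ := exists_nnreal_mul_eq (measure_ne_top τ {0}) (measure_ne_top τ₁ {0}) hτ₁
  exact ⟨r, by rw [hσ, hσ₁, mul_zero], hr⟩

/-- If both walks are complete, the balanced laws form a segment. -/
theorem exists_balancedLaws_eq_segment {a b : ℝ} (hab : 0 < a + b) {n m : ℕ}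
    (hn : IsCompleteWalk a b n) (hm : IsCompleteWalk b a m) :
    ∃ ν₁ ν₂, ν₁ ≠ ν₂ ∧ IsLadderDistribution n ν₁ ∧ IsLadderDistribution m ν₂ ∧
      balancedLaws a b = segment ℝ≥0 ν₁ ν₂ := by
  obtain ⟨σ₁, τ₁, h₁, hσ₁, hτ₁, hlad₁, -⟩ := hn.exists_isBalanced hab
  obtain ⟨τ₂, σ₂, h₂, hτ₂, hσ₂, -, hlad₂⟩ := hm.exists_isBalanced (by linarith)
  have h₂ := h₂.symm
  refine ⟨_, _, ?_, hlad₁, hlad₂, ?_⟩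
  · intro he
    have := congrArg (fun ν => ν {((1 : ℝ), a)}) he
    simp only [edgeLaw_singleton hab, hσ₂] at this
    exact hσ₁ this
  have hp₁ := hlad₁.1
  have hp₂ := hlad₂.1
  have huniv : ∀ r s : ℝ≥0, (r • edgeLaw a b σ₁ τ₁ + s • edgeLaw a b σ₂ τ₂) Set.univ =
      ((r + s : ℝ≥0) : ℝ≥0∞) := by
    intro r s
    rw [Measure.add_apply, Measure.smul_apply, Measure.smul_apply, hp₁.measure_univ,
      hp₂.measure_univ, ENNReal.smul_def, ENNReal.smul_def]
    simp
  ext μ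
  constructor
  · rintro ⟨hμ, σ, τ, h, rfl⟩
    have := h.finite_fst
    have := h.finite_snd
    have := h₁.finite_fst
    have := h₂.finite_snd
    obtain ⟨r, hr⟩ := exists_nnreal_mul_eq (measure_ne_top σ {0}) (measure_ne_top σ₁ {0}) hσ₁
    obtain ⟨s, hs⟩ := exists_nnreal_mul_eq (measure_ne_top τ {0}) (measure_ne_top τ₂ {0}) hτ₂
    obtain ⟨rfl, rfl⟩ := h.eq_of_measure_zero_eq ((h₁.smul r).add (h₂.smul s)) hab
      (by rw [Measure.add_apply, Measure.smul_apply, Measure.smul_apply, hσ₂, hr, smul_zero,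
        add_zero]; rfl)
      (by rw [Measure.add_apply, Measure.smul_apply, Measure.smul_apply, hτ₁, hs, smul_zero,
        zero_add]; rfl)
    have hrs := hμ.measure_univ
    rw [edgeLaw_add, edgeLaw_smul, edgeLaw_smul] at hrs ⊢
    rw [huniv] at hrs
    exact ⟨r, s, zero_le, zero_le, ENNReal.coe_eq_one.1 hrs, rfl⟩
  · rintro ⟨r, s, -, -, hrs, rfl⟩
    refine ⟨⟨by rw [huniv, hrs, ENNReal.coe_one]⟩, _, _, (h₁.smul r).add (h₂.smul s), ?_⟩
    rw [edgeLaw_add, edgeLaw_smul, edgeLaw_smul]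

theorem exists_isCompleteWalk_of_mem_balancedLaws {a b : ℝ} (hab : 0 < a + b)
    {μ : Measure (ℝ × ℝ)} (hμ : μ ∈ balancedLaws a b) :
    ∃ n, IsCompleteWalk a b n ∨ IsCompleteWalk b a n := by
  obtain ⟨hprob, σ, τ, h, rfl⟩ := hμ
  by_cases hσ : σ {0} = 0
  · by_cases hτ : τ {0} = 0
    · have hz : IsBalanced a b (0 : Measure ℝ) 0 := ⟨inferInstance, inferInstance, by simp,
        by simp, fun g _ => by simp, fun g _ => by simp⟩
      obtain ⟨rfl, rfl⟩ := h.eq_of_measure_zero_eq hz hab (by simpa using hσ) (by simpa using hτ)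
      have := hprob.measure_univ
      simp [edgeLaw] at this
    · obtain ⟨n, hn⟩ := h.symm.exists_isCompleteWalk (by linarith) hτ
      exact ⟨n, Or.inr hn⟩
  · obtain ⟨n, hn⟩ := h.exists_isCompleteWalk hab hσ
    exact ⟨n, Or.inl hn⟩

/-! ### Integrality conditions -/

theorem isCompleteWalk_odd_iff {a b : ℝ} (hab : 0 < a + b) {N : ℕ} (hN : 1 ≤ N) :
    IsCompleteWalk a b (2 * N - 1) ↔ (N - 1) * (a + b) + a = 1 ∧ 0 < a := by
  obtain ⟨k, rfl⟩ : ∃ k, N = k + 1 := ⟨N - 1, by omega⟩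
  rw [show 2 * (k + 1) - 1 = 2 * k + 1 by omega]
  push_cast
  rw [add_sub_cancel_right]
  constructor
  · intro h
    have h1 := h.eq_one
    rw [walk_two_mul_add_one] at h1
    refine ⟨h1, ?_⟩
    have := h.walk_mem_Ioc one_pos (by omega)
    simpa [walk] using this.1
  · rintro ⟨h1, ha⟩
    refine ⟨by omega, by rw [walk_two_mul_add_one, h1], fun j hj0 hj => ?_⟩
    obtain ⟨i, rfl | rfl⟩ := j.even_or_odd'
    · have hi0 : (1 : ℝ) ≤ i := by exact_mod_cast (show 1 ≤ i by omega)
      have hik : (i : ℝ) ≤ k := by exact_mod_cast (show i ≤ k by omega)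
      rw [walk_two_mul]
      constructor <;> nlinarith
    · have hi0 : (0 : ℝ) ≤ i := i.cast_nonneg
      have hik : (i : ℝ) + 1 ≤ k := by exact_mod_cast (show i + 1 ≤ k by omega)
      rw [walk_two_mul_add_one]
      constructor <;> nlinarith

theorem isCompleteWalk_even_iff {a b : ℝ} (hab : 0 < a + b) {N : ℕ} :
    IsCompleteWalk a b (2 * N) ↔ N * (a + b) = 1 ∧ 0 < a ∧ 0 < b := by
  constructor
  · intro h
    have hN := h.pos
    obtain ⟨k, rfl⟩ : ∃ k, N = k + 1 := ⟨N - 1, by omega⟩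
    have h1 := h.eq_one
    rw [walk_two_mul] at h1
    refine ⟨h1, ?_, ?_⟩
    · have := h.mem_Ioo 1 one_pos (by omega)
      simpa [walk] using this.1
    · have := h.mem_Ioo (2 * k + 1) (by omega) (by omega)
      rw [walk_two_mul_add_one] at this
      push_cast at h1
      linarith [this.2]
  · rintro ⟨h1, ha, hb⟩
    have hN : 0 < N := by
      rcases N.eq_zero_or_pos with rfl | h
      · simp at h1
      · exact h
    refine ⟨by omega, by rw [walk_two_mul, h1], fun j hj0 hj => ?_⟩
    obtain ⟨i, rfl | rfl⟩ := j.even_or_odd'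
    · have hi0 : (1 : ℝ) ≤ i := by exact_mod_cast (show 1 ≤ i by omega)
      have hiN : (i : ℝ) + 1 ≤ N := by exact_mod_cast (show i + 1 ≤ N by omega)
      rw [walk_two_mul]
      constructor <;> nlinarith
    · have hi0 : (0 : ℝ) ≤ i := i.cast_nonneg
      have hiN : (i : ℝ) + 1 ≤ N := by exact_mod_cast (show i + 1 ≤ N by omega)
      rw [walk_two_mul_add_one]
      constructor <;> nlinarith

/-- If the walk with first step `a` is complete after `2N - 1` steps, the other walk can only be
complete after the same number of steps: an even number `2k` would force `k < N < k + 1`, and an odd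
number `2k + 1` forces `k < N < k + 2`. -/
theorem eq_of_isCompleteWalk {a b : ℝ} (hab : 0 < a + b) {N m : ℕ} (hN : 1 ≤ N)
    (h : IsCompleteWalk a b (2 * N - 1)) (hm : IsCompleteWalk b a m) : m = 2 * N - 1 := by
  obtain ⟨h1, ha⟩ := (isCompleteWalk_odd_iff hab hN).1 h
  obtain ⟨k, rfl | rfl⟩ := m.even_or_odd'
  · exfalso
    obtain ⟨k1, hb, -⟩ := (isCompleteWalk_even_iff (by linarith)).1 hm
    have l1 : (k : ℝ) < N := by
      by_contra hc
      nlinarith [mul_nonneg hab.le (sub_nonneg.2 (not_lt.1 hc))]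
    have l2 : (N : ℝ) < k + 1 := by
      by_contra hc
      nlinarith [mul_nonneg hab.le (sub_nonneg.2 (not_lt.1 hc))]
    have l1' : k < N := by exact_mod_cast l1
    have l2' : N < k + 1 := by exact_mod_cast l2
    omega
  · rw [show 2 * k + 1 = 2 * (k + 1) - 1 by omega] at hm
    obtain ⟨k1, hb⟩ := (isCompleteWalk_odd_iff (by linarith) (by omega)).1 hm
    push_cast at k1
    have l1 : (k : ℝ) < N := by
      by_contra hc
      nlinarith [mul_nonneg hab.le (sub_nonneg.2 (not_lt.1 hc))]
    have l2 : (N : ℝ) < k + 2 := by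
      by_contra hc
      nlinarith [mul_nonneg hab.le (sub_nonneg.2 (not_lt.1 hc))]
    have l1' : k < N := by exact_mod_cast l1
    have l2' : N < k + 2 := by exact_mod_cast l2
    omega

theorem condOne_iff {α β p a b : ℝ} (hα : 0 < α) (hαβ : β < α)
    (ha : a = (2 - α / (α - β)) * p + α / (α - β) - 1) (hb : b = 1 - (2 - α / (α - β)) * p)
    (N : ℕ) : CondOne α β p N ↔ N * (a + b) = 1 ∧ 0 ≤ a ∧ 0 ≤ b := by
  have hne : α - β ≠ 0 := (sub_pos.2 hαβ).ne'
  have hc : a + b = α / (α - β) := by rw [ha, hb]; ring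
  refine and_congr ?_ (and_congr ?_ ?_)
  · rw [hc, div_eq_iff hα.ne', ← mul_div_assoc, div_eq_one_iff_eq hne, eq_comm]
  · rw [ha, sub_nonneg]
  · rw [hb, sub_nonneg]

theorem condTwo_iff {α β p a b : ℝ} (hp : p ∈ Set.Icc (0 : ℝ) 1) (hα : 0 < α) (hαβ : β < α)
    (ha : a = (2 - α / (α - β)) * p + α / (α - β) - 1) (hb : b = 1 - (2 - α / (α - β)) * p)
    (N : ℕ) : CondTwo α β p N ↔ 1 ≤ N ∧ (N - 1) * (a + b) + a = 1 ∧ 0 < a := by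
  have hαβ' : 0 < α - β := sub_pos.2 hαβ
  have hc : a + b = α / (α - β) := by rw [ha, hb]; ring
  have hc0 : 0 < a + b := hc ▸ div_pos hα hαβ'
  rw [← hc] at ha hb
  set c := a + b with hcdef
  have hα' : α = c * (α - β) := by rw [hc]; field_simp
  have e : (2 * (α - β) - (α - 2 * β) * p) / α = N ↔ (N - 1) * c + a = 1 := by
    rw [div_eq_iff hα.ne']
    constructor
    · intro h
      refine mul_left_cancel₀ hαβ'.ne' ?_
      rw [ha]
      linear_combination -h + (p - N) * hα'
    · intro h
      rw [ha] at h
      linear_combination -(α - β) * h + (p - N) * hα'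
  unfold CondTwo
  rw [e, ← hc]
  constructor
  · rintro ⟨h1, h2⟩
    refine ⟨?_, h1, by linarith⟩
    rcases N.eq_zero_or_pos with rfl | h
    · exfalso
      push_cast at h1
      nlinarith [hp.1, hp.2, mul_nonneg hc0.le hp.1]
    · exact h
  · rintro ⟨-, h1, h2⟩
    exact ⟨h1, by linarith⟩

/-- Exchanging the outcomes `0` and `1` exchanges the second and the third condition. -/
theorem condThree_iff_condTwo (α β p : ℝ) (N : ℕ) :
    CondThree α β p N ↔ CondTwo α β (1 - p) N := by
  refine and_congr Iff.rfl ?_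
  constructor <;> intro h <;> linarith

theorem condThree_iff {α β p a b : ℝ} (hp : p ∈ Set.Icc (0 : ℝ) 1) (hα : 0 < α) (hαβ : β < α)
    (ha : a = (2 - α / (α - β)) * p + α / (α - β) - 1) (hb : b = 1 - (2 - α / (α - β)) * p)
    (N : ℕ) : CondThree α β p N ↔ 1 ≤ N ∧ (N - 1) * (a + b) + b = 1 ∧ 0 < b := by
  rw [condThree_iff_condTwo, condTwo_iff (a := b) (b := a)
    ⟨by linarith [hp.2], by linarith [hp.1]⟩ hα hαβ (by rw [hb]; ring) (by rw [ha]; ring), add_comm b a]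

/-- One of the two walks is complete exactly under the integrality conditions. Under the first one
alone, a step may vanish; then the second or the third holds as well. -/
theorem exists_cond_iff_exists_isCompleteWalk {α β p a b : ℝ} (hp : p ∈ Set.Icc (0 : ℝ) 1)
    (hα : 0 < α) (hαβ : β < α) (ha : a = (2 - α / (α - β)) * p + α / (α - β) - 1)
    (hb : b = 1 - (2 - α / (α - β)) * p) :
    (∃ N : ℕ, CondOne α β p N ∨ CondTwo α β p N ∨ CondThree α β p N) ↔
      ∃ n, IsCompleteWalk a b n ∨ IsCompleteWalk b a n := by
  have hab : 0 < a + b := by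
    rw [show a + b = α / (α - β) by rw [ha, hb]; ring]
    exact div_pos hα (sub_pos.2 hαβ)
  have hba : 0 < b + a := by linarith
  have hodd : ∀ N : ℕ, ((N : ℝ) - 1) * (a + b) = ((N : ℝ) - 1) * (b + a) := fun N => by ring
  constructor
  · rintro ⟨N, h | h | h⟩
    · obtain ⟨h1, ha0, hb0⟩ := (condOne_iff hα hαβ ha hb N).1 h
      have hN : 1 ≤ N := by
        rcases N.eq_zero_or_pos with rfl | h
        · simp at h1
        · exact h
      rcases ha0.eq_or_lt with ha0 | ha0
      · exact ⟨2 * N - 1, Or.inr ((isCompleteWalk_odd_iff hba hN).2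
          ⟨by rw [← ha0] at h1 ⊢; linarith, by linarith⟩)⟩
      rcases hb0.eq_or_lt with hb0 | hb0
      · exact ⟨2 * N - 1, Or.inl ((isCompleteWalk_odd_iff hab hN).2
          ⟨by rw [← hb0] at h1 ⊢; linarith, by linarith⟩)⟩
      · exact ⟨2 * N, Or.inl ((isCompleteWalk_even_iff hab).2 ⟨h1, ha0, hb0⟩)⟩
    · obtain ⟨hN, h1⟩ := (condTwo_iff hp hα hαβ ha hb N).1 h
      exact ⟨_, Or.inl ((isCompleteWalk_odd_iff hab hN).2 h1)⟩
    · obtain ⟨hN, h1⟩ := (condThree_iff hp hα hαβ ha hb N).1 h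
      rw [hodd] at h1
      exact ⟨_, Or.inr ((isCompleteWalk_odd_iff hba hN).2 h1)⟩
  · rintro ⟨n, h⟩
    obtain ⟨k, rfl | rfl⟩ := n.even_or_odd'
    · refine ⟨k, Or.inl ((condOne_iff hα hαβ ha hb k).2 ?_)⟩
      rcases h with h | h
      · obtain ⟨h1, h2, h3⟩ := (isCompleteWalk_even_iff hab).1 h
        exact ⟨h1, h2.le, h3.le⟩
      · obtain ⟨h1, h2, h3⟩ := (isCompleteWalk_even_iff hba).1 h
        exact ⟨by rwa [add_comm a b], h3.le, h2.le⟩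
    · have e : 2 * k + 1 = 2 * (k + 1) - 1 := by omega
      have hk : 1 ≤ k + 1 := by omega
      rw [e] at h
      refine ⟨k + 1, Or.inr ?_⟩
      rcases h with h | h
      · exact Or.inl ((condTwo_iff hp hα hαβ ha hb _).2
          ⟨hk, (isCompleteWalk_odd_iff hab hk).1 h⟩)
      · refine Or.inr ((condThree_iff hp hα hαβ ha hb _).2 ⟨hk, ?_⟩)
        rw [hodd]
        exact (isCompleteWalk_odd_iff hba hk).1 h

/-! ### The optimal distributions -/

theorem mem_balancedLaws_of_integral_eq {α β p a b : ℝ} (hαβ : β < α)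
    (ha : a = (2 - α / (α - β)) * p + α / (α - β) - 1) (hb : b = 1 - (2 - α / (α - β)) * p)
    {μ : Measure (ℝ × ℝ)} (hμ : μ ∈ coherentSet p)
    (heq : ∫ z, quadObjective α β p z ∂μ = p * (1 - p) * (α ^ 2 / (α - β))) :
    μ ∈ balancedLaws a b := by
  obtain ⟨μ₀, μ₁, h, rfl, hprob, hp⟩ := exists_isCoherentPair_of_mem_coherentSet hμ
  obtain ⟨h0, h1⟩ := (h.integral_quadObjective_eq_iff hprob hp hαβ).1 heq
  exact ⟨hprob, h.exists_isBalanced (h0.mono fun z hz => by rw [hz, hb]; ring)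
    (h1.mono fun z hz => by rw [hz, ha]; ring)⟩

/-- A balanced law attains the bound. Its mean is `p`, because the mean `q` of each forecast satisfies
`2 q = (2 - c) p + c q`, where `c = α / (α - β) ≠ 2`. -/
theorem mem_coherentSet_of_mem_balancedLaws {α β p a b : ℝ} (hαβ : 2 * β < α) (hα : 0 < α)
    (ha : a = (2 - α / (α - β)) * p + α / (α - β) - 1) (hb : b = 1 - (2 - α / (α - β)) * p)
    {μ : Measure (ℝ × ℝ)} (hμ : μ ∈ balancedLaws a b) :
    μ ∈ coherentSet p ∧
      ∫ z, quadObjective α β p z ∂μ = p * (1 - p) * (α ^ 2 / (α - β)) := by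
  have hβα : β < α := by linarith
  obtain ⟨hprob, σ, τ, h, rfl⟩ := hμ
  have hpair := h.isCoherentPair
  have hsum : edgeLaw a b σ τ = (τ.map fun t => (1 - (t + b), t)) +
    (σ.map fun s => (1 - s, s + a)) := add_comm _ _
  rw [hsum] at hprob ⊢
  have h0 : ∀ᵐ z ∂(τ.map fun t => (1 - (t + b), t)), z.1 + z.2 = (2 - α / (α - β)) * p := by
    rw [ae_map_iff (by fun_prop) (measurableSet_eq_fun (by fun_prop) (by fun_prop))]
    refine .of_forall fun t => ?_
    dsimp only
    rw [hb]
    ring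
  have h1 : ∀ᵐ z ∂(σ.map fun s => (1 - s, s + a)),
      z.1 + z.2 = (2 - α / (α - β)) * p + α / (α - β) := by
    rw [ae_map_iff (by fun_prop) (measurableSet_eq_fun (by fun_prop) (by fun_prop))]
    refine .of_forall fun t => ?_
    dsimp only
    rw [ha]
    ring
  set μ₀ := τ.map fun t => (1 - (t + b), t)
  set μ₁ := σ.map fun s => (1 - s, s + a)
  have := hpair.finite₀
  have := hpair.finite₁
  have hp : μ₁.real Set.univ = p := by
    have hq0 : μ₀.real Set.univ = 1 - μ₁.real Set.univ := by
      have : (μ₀ + μ₁).real Set.univ = 1 := by simp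
      rw [measureReal_add_apply] at this
      linarith
    have i0 : ∀ {f : ℝ × ℝ → ℝ}, Continuous f → Integrable f μ₀ := fun hf =>
      integrable_of_ae_mem_unitSquare hpair.mem₀ hf
    have i1 : ∀ {f : ℝ × ℝ → ℝ}, Continuous f → Integrable f μ₁ := fun hf =>
      integrable_of_ae_mem_unitSquare hpair.mem₁ hf
    have e1 := hpair.fst.integral_eq measurable_fst (hpair.mem₀.mono fun z h => h.1)
      (hpair.mem₁.mono fun z h => h.1) (φ := fun _ => 1) measurable_const
    have e2 := hpair.snd.integral_eq measurable_snd (hpair.mem₀.mono fun z h => h.2)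
      (hpair.mem₁.mono fun z h => h.2) (φ := fun _ => 1) measurable_const
    simp only [one_mul] at e1 e2
    rw [integral_sub (integrable_const _) (i1 continuous_fst), integral_const, smul_eq_mul,
      mul_one] at e1
    rw [integral_sub (integrable_const _) (i1 continuous_snd), integral_const, smul_eq_mul,
      mul_one] at e2
    have s0 := integral_congr_ae h0
    have s1 := integral_congr_ae h1
    rw [integral_add (i0 continuous_fst) (i0 continuous_snd), integral_const, smul_eq_mul, hq0]
      at s0
    rw [integral_add (i1 continuous_fst) (i1 continuous_snd), integral_const, smul_eq_mul] at s1
    have hc : 2 - α / (α - β) ≠ 0 := by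
      have : α / (α - β) < 2 := by
        rw [div_lt_iff₀ (by linarith)]
        linarith
      linarith
    refine mul_left_cancel₀ hc ?_
    linarith
  exact ⟨hp ▸ hpair.add_mem_coherentSet hprob,
    (hpair.integral_quadObjective_eq_iff hprob hp hβα).2 ⟨h0, h1⟩⟩

theorem maximizers_eq_balancedLaws {α β p a b : ℝ} (hαβ : 2 * β < α) (hα : 0 < α)
    (ha : a = (2 - α / (α - β)) * p + α / (α - β) - 1) (hb : b = 1 - (2 - α / (α - β)) * p)
    (hne : (balancedLaws a b).Nonempty) : maximizers α β p = balancedLaws a b := by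
  have hβα : β < α := by linarith
  ext μ
  constructor
  · rintro ⟨hμ, hmax⟩
    obtain ⟨ν, hν⟩ := hne
    obtain ⟨hν', heq⟩ := mem_coherentSet_of_mem_balancedLaws hαβ hα ha hb hν
    exact mem_balancedLaws_of_integral_eq hβα ha hb hμ
      ((integral_quadObjective_le_of_mem_coherentSet hμ hβα).antisymm (heq ▸ hmax ν hν'))
  · intro hμ
    obtain ⟨hμ', heq⟩ := mem_coherentSet_of_mem_balancedLaws hαβ hα ha hb hμ
    exact ⟨hμ', fun ν hν => heq ▸ integral_quadObjective_le_of_mem_coherentSet hν hβα⟩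

theorem balancedLaws_nonempty {a b : ℝ} (hab : 0 < a + b) {n : ℕ}
    (h : IsCompleteWalk a b n ∨ IsCompleteWalk b a n) : (balancedLaws a b).Nonempty := by
  rcases h with h | h
  · obtain ⟨σ, τ, hb, -, -, hl, -⟩ := h.exists_isBalanced hab
    exact ⟨_, hl.1, σ, τ, hb, rfl⟩
  · obtain ⟨τ, σ, hb, -, -, -, hl⟩ := h.exists_isBalanced (by linarith)
    exact ⟨_, hl.1, σ, τ, hb.symm, rfl⟩

theorem eq_smul_dirac_of_ae_eq {ν : Measure (ℝ × ℝ)} {x : ℝ × ℝ} (h : ∀ᵐ z ∂ν, z = x) :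
    ν = ν Set.univ • Measure.dirac x := by
  rw [← Measure.map_const]
  conv_lhs => rw [← Measure.map_id (μ := ν)]
  exact Measure.map_congr h

/-- For `α = 2β` the two lines meet the unit square only in its corners `(0, 0)` and `(1, 1)`. -/
theorem eq_fullyInformed_of_integral_eq {β p : ℝ} (hβ : 0 < β) {μ : Measure (ℝ × ℝ)}
    (hμ : μ ∈ coherentSet p)
    (heq : ∫ z, quadObjective (2 * β) β p z ∂μ = 4 * β * (p * (1 - p))) :
    μ = fullyInformed p := by
  obtain ⟨μ₀, μ₁, h, rfl, hprob, hp⟩ := exists_isCoherentPair_of_mem_coherentSet hμ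
  have := h.finite₀
  have := h.finite₁
  have hc : 2 * β / (2 * β - β) = 2 := by
    rw [div_eq_iff (by linarith)]
    ring
  have hbound : p * (1 - p) * ((2 * β) ^ 2 / (2 * β - β)) = 4 * β * (p * (1 - p)) := by
    have : 2 * β - β ≠ 0 := by linarith
    field_simp
    ring
  obtain ⟨h0, h1⟩ := (h.integral_quadObjective_eq_iff hprob hp (by linarith)).1
    (heq.trans hbound.symm)
  rw [hc] at h0 h1
  have e0 : ∀ᵐ z ∂μ₀, z = (0, 0) := by
    filter_upwards [h.mem₀, h0] with z hz hz0
    exact Prod.ext (by linarith [hz.1.1, hz.2.1]) (by linarith [hz.1.1, hz.2.1])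
  have e1 : ∀ᵐ z ∂μ₁, z = (1, 1) := by
    filter_upwards [h.mem₁, h1] with z hz hz1
    exact Prod.ext (by linarith [hz.1.2, hz.2.2]) (by linarith [hz.1.2, hz.2.2])
  have hp0 : μ₀.real Set.univ = 1 - p := by
    have : (μ₀ + μ₁).real Set.univ = 1 := by simp
    rw [measureReal_add_apply] at this
    linarith
  rw [fullyInformed, ← hp0, ← hp, ofReal_measureReal, ofReal_measureReal,
    ← eq_smul_dirac_of_ae_eq e0, ← eq_smul_dirac_of_ae_eq e1]

theorem maximizers_eq_fullyInformed {β p : ℝ} (hp : p ∈ Set.Icc (0 : ℝ) 1) (hβ : 0 < β) :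
    maximizers (2 * β) β p = {fullyInformed p} := by
  have hmax := isGreatest_objectiveValues_of_le hp hβ le_rfl
  ext μ
  constructor
  · rintro ⟨hμ, h⟩
    refine eq_fullyInformed_of_integral_eq hβ hμ ((hmax.2 ⟨μ, hμ, rfl⟩).antisymm ?_)
    rw [← integral_quadObjective_fullyInformed hp (2 * β) β]
    exact h _ (fullyInformed_mem_coherentSet hp)
  · rintro rfl
    refine ⟨fullyInformed_mem_coherentSet hp, fun ν hν => ?_⟩
    rw [integral_quadObjective_fullyInformed hp]
    exact hmax.2 ⟨ν, hν, rfl⟩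

theorem isGreatest_eq_bound_iff {α β p M : ℝ} (hp : p ∈ Set.Icc (0 : ℝ) 1) (hα : 0 < α)
    (hαβ : 2 * β ≤ α) (hM : IsGreatest (objectiveValues α β p) M) :
    M = p * (1 - p) * (α ^ 2 / (α - β)) ↔
      ∃ N : ℕ, CondOne α β p N ∨ CondTwo α β p N ∨ CondThree α β p N := by
  have hβα : β < α := by linarith
  rw [exists_cond_iff_exists_isCompleteWalk hp hα hβα rfl rfl]
  set a := (2 - α / (α - β)) * p + α / (α - β) - 1 with ha
  set b := 1 - (2 - α / (α - β)) * p with hb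
  have hab : 0 < a + b := by
    rw [show a + b = α / (α - β) by rw [ha, hb]; ring]
    exact div_pos hα (sub_pos.2 hβα)
  constructor
  · intro h
    obtain ⟨μ, hμ, hμM⟩ := hM.1
    exact exists_isCompleteWalk_of_mem_balancedLaws hab
      (mem_balancedLaws_of_integral_eq hβα ha hb hμ (hμM.trans h))
  · rintro ⟨n, hn⟩
    have hle : M ≤ p * (1 - p) * (α ^ 2 / (α - β)) := by
      obtain ⟨μ, hμ, rfl⟩ := hM.1
      exact integral_quadObjective_le_of_mem_coherentSet hμ hβα
    refine hle.antisymm ?_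
    rcases hαβ.eq_or_lt with heq | hlt
    · refine le_of_eq_of_le ?_ (hM.2 ⟨_, fullyInformed_mem_coherentSet hp, rfl⟩)
      dsimp only
      rw [integral_quadObjective_fullyInformed hp, ← heq]
      have : 2 * β - β ≠ 0 := by linarith
      field_simp
      ring
    · obtain ⟨ν, hν⟩ := balancedLaws_nonempty hab hn
      obtain ⟨hν', he⟩ := mem_coherentSet_of_mem_balancedLaws hlt hα ha hb hν
      exact he ▸ hM.2 ⟨ν, hν', rfl⟩

theorem theorem1p1 (α β p : ℝ) (hp : p ∈ Set.Icc (0 : ℝ) 1) :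
    -- the case `α < 0` or `2β > α`: the exact value of the maximum
    ((α < 0 ∨ 2 * β > α) →
      IsGreatest (objectiveValues α β p) (max 0 (max (4 * β) (α + β)) * (p * (1 - p)))) ∧
    -- the case `α ≥ max (0, 2β)`: the maximum exists and is bounded; the case of equality
    (α ≥ max 0 (2 * β) →
      ∃ M : ℝ, IsGreatest (objectiveValues α β p) M ∧
        M ≤ p * (1 - p) * (α ^ 2 / (α - β)) ∧
        (0 < α →
          (M = p * (1 - p) * (α ^ 2 / (α - β)) ↔
            ∃ N : ℕ, CondOne α β p N ∨ CondTwo α β p N ∨ CondThree α β p N)) ∧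
        (α = 0 → M = 0)) ∧
    -- the optimal distributions in the case of equality
    (0 < α → 2 * β < α → ∀ N : ℕ,
      (Xor (CondTwo α β p N) (CondThree α β p N) →
        ∃ ν : Measure (ℝ × ℝ), IsLadderDistribution (2 * N - 1) ν ∧ maximizers α β p = {ν}) ∧
      (CondTwo α β p N ∧ CondThree α β p N →
        ∃ ν₁ ν₂ : Measure (ℝ × ℝ), ν₁ ≠ ν₂ ∧
          IsLadderDistribution (2 * N - 1) ν₁ ∧ IsLadderDistribution (2 * N - 1) ν₂ ∧
          maximizers α β p = segment ℝ≥0 ν₁ ν₂) ∧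
      (CondOne α β p N ∧ ¬ CondTwo α β p N ∧ ¬ CondThree α β p N →
        ∃ ν₁ ν₂ : Measure (ℝ × ℝ), ν₁ ≠ ν₂ ∧
          IsLadderDistribution (2 * N) ν₁ ∧ IsLadderDistribution (2 * N) ν₂ ∧
          maximizers α β p = segment ℝ≥0 ν₁ ν₂)) ∧
    -- the degenerate boundary case `α = 2β > 0`
    (0 < α → α = 2 * β →
      maximizers α β p =
        {ENNReal.ofReal (1 - p) • Measure.dirac ((0 : ℝ), (0 : ℝ)) +
          ENNReal.ofReal p • Measure.dirac ((1 : ℝ), (1 : ℝ))}) := by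
  refine ⟨isGreatest_objectiveValues_of_neg_or_lt hp, fun h => ?_, fun hα hαβ N => ?_,
    fun hα hαβ => ?_⟩
  · have h0 : 0 ≤ α := (le_max_left _ _).trans h
    have h2 : 2 * β ≤ α := (le_max_right _ _).trans h
    rcases h0.eq_or_lt with rfl | hα
    · exact ⟨0, isGreatest_objectiveValues_zero hp le_rfl (by linarith), by simp,
        fun h => absurd h (lt_irrefl _), fun _ => rfl⟩
    · obtain ⟨M, hM⟩ := exists_isGreatest_objectiveValues α β ⟨_, dirac_mem_coherentSet hp⟩
      refine ⟨M, hM, ?_, fun _ => isGreatest_eq_bound_iff hp hα h2 hM, fun h => absurd h hα.ne'⟩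
      obtain ⟨μ, hμ, rfl⟩ := hM.1
      exact integral_quadObjective_le_of_mem_coherentSet hμ (by linarith)
  · have hβα : β < α := by linarith
    rw [condOne_iff hα hβα rfl rfl N, condTwo_iff hp hα hβα rfl rfl N,
      condThree_iff hp hα hβα rfl rfl N]
    have hmax := maximizers_eq_balancedLaws (p := p) hαβ hα rfl rfl
    set a := (2 - α / (α - β)) * p + α / (α - β) - 1 with ha
    set b := 1 - (2 - α / (α - β)) * p with hb
    have hab : 0 < a + b := by
      rw [show a + b = α / (α - β) by rw [ha, hb]; ring]
      exact div_pos hα (sub_pos.2 hβα)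
    have hba : 0 < b + a := by linarith
    have two : 1 ≤ N ∧ (N - 1) * (a + b) + a = 1 ∧ 0 < a ↔
        1 ≤ N ∧ IsCompleteWalk a b (2 * N - 1) :=
      and_congr_right fun hN => (isCompleteWalk_odd_iff hab hN).symm
    have three : 1 ≤ N ∧ (N - 1) * (a + b) + b = 1 ∧ 0 < b ↔
        1 ≤ N ∧ IsCompleteWalk b a (2 * N - 1) := by
      rw [add_comm a b]
      exact and_congr_right fun hN => (isCompleteWalk_odd_iff hba hN).symm
    have ne : ∀ n, IsCompleteWalk a b n ∨ IsCompleteWalk b a n →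
        maximizers α β p = balancedLaws a b := fun n hn => hmax (balancedLaws_nonempty hab hn)
    rw [two, three]
    refine ⟨?_, ?_, ?_⟩
    · rintro (⟨⟨hN, h⟩, hn⟩ | ⟨⟨hN, h⟩, hn⟩)
      · rw [ne _ (Or.inl h)]
        refine exists_balancedLaws_eq_singleton hab h fun m hm => hn ⟨hN, ?_⟩
        rwa [← eq_of_isCompleteWalk hab hN h hm]
      · rw [ne _ (Or.inr h)]
        refine exists_balancedLaws_eq_singleton' hab h fun m hm => hn ⟨hN, ?_⟩
        rwa [← eq_of_isCompleteWalk hba hN h hm]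
    · rintro ⟨⟨hN, h⟩, -, h'⟩
      rw [ne _ (Or.inl h)]
      exact exists_balancedLaws_eq_segment hab h h'
    · rintro ⟨⟨h1, ha0, hb0⟩, h2, h3⟩
      have hN : 1 ≤ N := by
        rcases N.eq_zero_or_pos with rfl | h
        · simp at h1
        · exact h
      -- If a step vanishes, the first condition turns into the second or the third.
      have ha0 : 0 < a := by
        refine ha0.lt_of_ne fun hz => h3 (three.1 ⟨hN, ?_, ?_⟩)
        · rw [← hz] at h1 ⊢
          linarith
        · linarith
      have hb0 : 0 < b := by
        refine hb0.lt_of_ne fun hz => h2 (two.1 ⟨hN, ?_, ?_⟩)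
        · rw [← hz] at h1 ⊢
          linarith
        · linarith
      have h := (isCompleteWalk_even_iff hab).2 ⟨h1, ha0, hb0⟩
      have h' : IsCompleteWalk b a (2 * N) :=
        (isCompleteWalk_even_iff hba).2 ⟨by rwa [add_comm b a], hb0, ha0⟩
      rw [ne _ (Or.inl h)]
      exact exists_balancedLaws_eq_segment hab h h'
  · rw [hαβ]
    exact maximizers_eq_fullyInformed hp (by linarith)
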